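/- Let $C=\begin{pmatrix}a&b\\c&d\end{pmatrix}$ be a unitary matrix with $b\neq 0$ (equivalently $|a|<1$), and put $P=\begin{pmatrix}a&b\\0&0\end{pmatrix}$, $Q=\begin{pmatrix}0&0\\c&d\end{pmatrix}$. Let $\varphi\in\mathbb{C}^2$ be a unit vector and let $\Psi_n:\mathbb{Z}\to\mathbb{C}^2$ be the quantum walk started at the origin: $\Psi_0(0)=\varphi$, $\Psi_0(x)=0$ for $x\ne0$, and $\Psi_{n+1}(x)=P\Psi_n(x+1)+Q\Psi_n(x-1)$. Let $p_n(x),q_n(x)$ be real numbers with $\|P\Psi_n(x)\|^2=p_n(x)\|\Psi_n(x)\|^2$ and $\|Q\Psi_n(x)\|^2=q_n(x)\|\Psi_n(x)\|^2$ (they are arbitrary where $\Psi_n(x)=0$, in particular where $n+x$ is odd). Put $\tau_1(s)=\frac{1-s}{2}$. For functions $f_n,f\in L^2(\mathbb{R})$ write $\operatorname{w-lim}_{n\to\infty}f_n=f$ if $\lim_{n\to\infty}\int_{-\infty}^y f_n(s)g(s)\,ds=\int_{-\infty}^y f(s)g(s)\,ds$ for all $g\in L^2(\mathbb{R})$ and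 $y\in\mathbb{R}$. **Theorem (Inside the peaks).** There are real functions $\xi_n,\eta_n,\zeta_n\in L^2(\mathbb{R})$ $(n\ge 0)$ with $$\operatorname{w-lim}_{n\to\infty}\xi_n=\operatorname{w-lim}_{n\to\infty}\eta_n=\operatorname{w-lim}_{n\to\infty}\zeta_n=0$$ such that, for every $s\in(-|a|,|a|)$, every $n\ge 0$ and every integer $x_n$ with $|x_n-ns|<1$ and $\Psi_n(x_n)\neq0$, one has $1+\eta_n(s)\ne0$ and $$p_n(x_n)=\frac{\tau_1(s)+\xi_n(s)}{1+\eta_n(s)},\qquad q_n(x_n)=\frac{(1-\tau_1(s))+\zeta_n(s)}{1+\eta_n(s)}.$$ (In particular this applies, for all large $n$ with $\Psi_n(x_n)\ne0$, to any integers with $x_n=ns+O(1/n)$.) Moreover, these are decompositions of the numerators and of the denominator of $p_n$ and $q_n$: there is a function $w>0$ on $(-|a|,|a|)$, independent of $n$, such that for every $r<|a|$ and all sufficiently large $n$ (depending on $r$), for all $|s|\le r$ and every integer $x_n$ with $|x_n-ns|<1$ and $n+x_n$ even, $$n\|\Psi_n(x_n)\|^2=w(s)(1+\eta_n(s)),\quad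 n\|P\Psi_n(x_n)\|^2=w(s)(\tau_1(s)+\xi_n(s)),\quad n\|Q\Psi_n(x_n)\|^2=w(s)(1-\tau_1(s)+\zeta_n(s)).$$ -/

import Mathlib

open MeasureTheory Filter Topology

noncomputable section

namespace QWalk

/-- The part of the coin matrix that sends the walker to the left: the upper row of `C`. -/
def P (C : Matrix (Fin 2) (Fin 2) ℂ) : Matrix (Fin 2) (Fin 2) ℂ :=
  !![C 0 0, C 0 1; 0, 0]

/-- The part of the coin matrix that sends the walker to the right: the lower row of `C`. -/
def Q (C : Matrix (Fin 2) (Fin 2) ℂ) : Matrix (Fin 2) (Fin 2) ℂ :=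
  !![0, 0; C 1 0, C 1 1]

/-- A complex 2 × 2 matrix applied to a vector of `ℂ²` (with the Euclidean norm). -/
def act (M : Matrix (Fin 2) (Fin 2) ℂ) (v : EuclideanSpace ℂ (Fin 2)) :
    EuclideanSpace ℂ (Fin 2) :=
  WithLp.toLp 2 (M.mulVec v.ofLp)

/-- The amplitude vector `Ψ_n(x)` of the quantum walk on `ℤ` with homogeneous coin `C`, started at
the origin in the internal state `φ`. -/
def Psi (C : Matrix (Fin 2) (Fin 2) ℂ) (φ : EuclideanSpace ℂ (Fin 2)) :
    ℕ → ℤ → EuclideanSpace ℂ (Fin 2)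
  | 0, x => if x = 0 then φ else 0
  | n + 1, x => act (P C) (Psi C φ n (x + 1)) + act (Q C) (Psi C φ n (x - 1))

/-- The function `τ₁(s) = (1 - s) / 2`. -/
def tau1 (s : ℝ) : ℝ := (1 - s) / 2

/-- `F` is the weak limit of the sequence `f`: all these functions are in `L²(ℝ)`, and the integrals
over `(-∞, y]` against any `L²` function converge, for every `y`. -/
def IsWeakLimit (f : ℕ → ℝ → ℝ) (F : ℝ → ℝ) : Prop :=
  (∀ n, MemLp (f n) 2 volume) ∧ MemLp F 2 volume ∧
    ∀ g : ℝ → ℝ, MemLp g 2 volume → ∀ y : ℝ,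
      Tendsto (fun n => ∫ s in Set.Iic y, f n s * g s) atTop
        (𝓝 (∫ s in Set.Iic y, F s * g s))

end QWalk

end

/-! Removing phases from the coin reduces it to the real matrix with rows `(a, b)` and `(-b, a)`,
where `a = ‖C 0 0‖` and `b = ‖C 0 1‖`. Its Fourier symbol has eigenvalues `exp(± i ω(k))` with `cos
ω(k) = a cos k`. At sites of the right parity the components of `Ψ_n(x)` are therefore, up to
unimodular factors, integrals over `[-π/2, π/2]` of `exp(± i (n ω(k) - x k))` against smooth
spectral amplitudes (`exists_norm_Psi_eq_oscInt`). There `ω'` increases from `-a` to `a`, so each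
velocity `s` in `(-a, a)` has exactly one stationary point `κ(s)`, and it is nondegenerate.
Stationary phase, uniform on compact sets of velocities, gives the leading term
(`oscInt_asymptotic`).

The two branches interfere: `n` times a squared modulus is asymptotically a mean part plus `Re(c(s)
z_n(s))` with `|z_n| = 1`. On each eigenvector the ratio of the two components is fixed by the group
velocity, so the mean parts belonging to `P` and `Q` are in the ratio `(1 - s) : (1 + s)`
(`norm_amp_relation`). This is the source of `τ₁`.

The interference vanishes weakly (`tendsto_integral_oscFactor_mul`). Moving `s` by `2/n` moves the
site by two and asymptotically multiplies `z_n` by `exp(-4 i κ(s))`, because the phase per step has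
derivative `-κ`. Translation by `2/n` is negligible in `L¹`, hence `∫ z_n (1 - exp(-4 i κ)) G → 0`
for integrable `G` supported in `(-a, a)`. The bracket vanishes only at `s = 0`, so every integrable
test function is a limit of such products.

The error functions are obtained by solving the required identities for them. Where the normalized
density is not yet bounded, the normalization is changed so that the quotients stay exact and the
errors stay bounded (`deviation`). -/

noncomputable section

namespace QWalk

/-! ### Oscillatory integrals: stationary phase with a uniform error -/

/-- The first derivative test for oscillatory integrals, away from a stationary point `t₀`. -/
lemma norm_integral_exp_mul_le {p q δ t₀ m M B B₁ : ℝ} {h h₁ h₂ A A₁ : ℝ → ℂ} (hpq : p ≤ q)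
    (hδ : 0 < δ) (hm : 0 < m)
    (hdist : ∀ t ∈ Set.Icc p q, δ ≤ |t - t₀|)
    (hh : ∀ t, HasDerivAt h (h₁ t) t) (hh₁ : ∀ t, HasDerivAt h₁ (h₂ t) t)
    (hA : ∀ t, HasDerivAt A (A₁ t) t) (hh₂c : Continuous h₂) (hA₁c : Continuous A₁)
    (hre : ∀ t, (h t).re ≤ 0)
    (hlow : ∀ t ∈ Set.Icc p q, m * |t - t₀| ≤ ‖h₁ t‖)
    (hup : ∀ t ∈ Set.Icc p q, ‖h₂ t‖ ≤ M)
    (hB : ∀ t ∈ Set.Icc p q, ‖A t‖ ≤ B)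
    (hB₁ : ∀ t ∈ Set.Icc p q, ‖A₁ t‖ * |t - t₀| ≤ B₁) :
    ‖∫ t in p..q, Complex.exp (h t) * A t‖ ≤ 2 / δ * (B / m + B₁ / m + B * M / m ^ 2) := by
  have hIcc : Set.uIcc p q = Set.Icc p q := Set.uIcc_of_le hpq
  have hpos : ∀ t ∈ Set.Icc p q, 0 < |t - t₀| := fun t ht => hδ.trans_le (hdist t ht)
  have hne : ∀ t ∈ Set.Icc p q, h₁ t ≠ 0 := fun t ht h0 => by
    have := hlow t ht
    rw [h0, norm_zero] at this
    exact absurd this (not_le.mpr (mul_pos hm (hpos t ht)))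
  have hhc : Continuous h := continuous_iff_continuousAt.mpr fun t => (hh t).continuousAt
  have hh₁c : Continuous h₁ := continuous_iff_continuousAt.mpr fun t => (hh₁ t).continuousAt
  have hAc : Continuous A := continuous_iff_continuousAt.mpr fun t => (hA t).continuousAt
  have hp : p ∈ Set.Icc p q := ⟨le_rfl, hpq⟩
  have hq : q ∈ Set.Icc p q := ⟨hpq, le_rfl⟩
  have hB0 : 0 ≤ B := (norm_nonneg _).trans (hB p hp)
  have hM0 : 0 ≤ M := (norm_nonneg _).trans (hup p hp)
  have hB10 : 0 ≤ B₁ := (by positivity : (0:ℝ) ≤ ‖A₁ p‖ * |p - t₀|).trans (hB₁ p hp)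
  set u' : ℝ → ℂ := fun t => (A₁ t * h₁ t - A t * h₂ t) / h₁ t ^ 2 with hu'
  have hu'c : ContinuousOn u' (Set.Icc p q) := by
    apply ContinuousOn.div
    · exact ((hA₁c.mul hh₁c).sub (hAc.mul hh₂c)).continuousOn
    · exact (hh₁c.pow 2).continuousOn
    · intro t ht; exact pow_ne_zero _ (hne t ht)
  have hexp : ∀ t, ‖Complex.exp (h t)‖ ≤ 1 := fun t => by
    rw [Complex.norm_exp]; exact Real.exp_le_one_iff.mpr (hre t)
  -- Integration by parts with `exp(h) A = (A / h₁) (exp h)'`. Since `Re h ≤ 0`, the exponential is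
  -- bounded by 1 for decaying and for purely oscillating integrands alike.
  have ibp := intervalIntegral.integral_mul_deriv_eq_deriv_mul (a := p) (b := q)
    (u := fun t => A t / h₁ t) (v := fun t => Complex.exp (h t)) (u' := u')
    (v' := fun t => Complex.exp (h t) * h₁ t)
    (fun t ht => (hA t).div (hh₁ t) (hne t (hIcc ▸ ht)))
    (fun t _ => (hh t).cexp)
    (ContinuousOn.intervalIntegrable (hIcc ▸ hu'c))
    ((hhc.cexp.mul hh₁c).intervalIntegrable _ _)
  have heq : ∫ t in p..q, Complex.exp (h t) * A t
      = ∫ t in p..q, A t / h₁ t * (Complex.exp (h t) * h₁ t) := by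
    apply intervalIntegral.integral_congr
    intro t ht
    have := hne t (hIcc ▸ ht)
    simp only
    field_simp
  have hend : ∀ t ∈ Set.Icc p q, ‖A t / h₁ t * Complex.exp (h t)‖ ≤ 1 / δ * (B / m) := fun t ht => by
    rw [norm_mul, norm_div]
    have h1 : ‖A t‖ / ‖h₁ t‖ ≤ B / (m * δ) := by
      apply div_le_div₀ hB0 (hB t ht) (by positivity)
      exact (mul_le_mul_of_nonneg_left (hdist t ht) hm.le).trans (hlow t ht)
    calc _ ≤ B / (m * δ) * 1 := mul_le_mul h1 (hexp t) (norm_nonneg _) (by positivity)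
      _ = 1 / δ * (B / m) := by field_simp
  -- The derivative of `A / h₁` is at most `K / (t - t₀)²`. The integral of this is controlled by
  -- `δ` alone, so the length of the interval does not enter.
  set K := B₁ / m + B * M / m ^ 2 with hK
  have hK0 : 0 ≤ K := by positivity
  have hu'b : ∀ t ∈ Set.Icc p q, ‖u' t * Complex.exp (h t)‖ ≤ K * (1 / (t - t₀) ^ 2) := fun t ht => by
    have ht0 := hpos t ht
    have hl := hlow t ht
    have hh1 : 0 < ‖h₁ t‖ := (mul_pos hm ht0).trans_le hl
    have e1 : u' t = A₁ t / h₁ t - A t * h₂ t / h₁ t ^ 2 := by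
      have := hne t ht
      simp only [hu']; field_simp
    have b1 : ‖A₁ t / h₁ t‖ ≤ B₁ / m * (1 / (t - t₀) ^ 2) := by
      rw [norm_div, div_le_iff₀ hh1]
      have : B₁ / m * (1 / (t - t₀) ^ 2) * (m * |t - t₀|) ≤ B₁ / m * (1 / (t - t₀) ^ 2) * ‖h₁ t‖ :=
        mul_le_mul_of_nonneg_left hl (by positivity)
      refine le_trans ?_ this
      rw [← sq_abs (t - t₀)]
      have := hB₁ t ht
      have e : B₁ / m * (1 / |t - t₀| ^ 2) * (m * |t - t₀|) = B₁ / |t - t₀| := by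
        field_simp
      rw [e, le_div_iff₀ ht0]; exact this
    have b2 : ‖A t * h₂ t / h₁ t ^ 2‖ ≤ B * M / m ^ 2 * (1 / (t - t₀) ^ 2) := by
      rw [norm_div, norm_mul, norm_pow]
      calc _ ≤ B * M / (m * |t - t₀|) ^ 2 := by
            apply div_le_div₀ (by positivity)
              (mul_le_mul (hB t ht) (hup t ht) (norm_nonneg _) hB0) (by positivity)
            exact pow_le_pow_left₀ (by positivity) hl 2
        _ = _ := by rw [mul_pow, sq_abs]; field_simp
    calc ‖u' t * Complex.exp (h t)‖ ≤ ‖u' t‖ * 1 := by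
          rw [norm_mul]; exact mul_le_mul_of_nonneg_left (hexp t) (norm_nonneg _)
      _ ≤ ‖A₁ t / h₁ t‖ + ‖A t * h₂ t / h₁ t ^ 2‖ := by rw [mul_one, e1]; exact norm_sub_le _ _
      _ ≤ _ := by rw [hK, add_mul]; exact add_le_add b1 b2
  have hsq : ∀ t ∈ Set.Icc p q, t - t₀ ≠ 0 := fun t ht => abs_pos.mp (hpos t ht)
  have hint : ∫ t in p..q, K * (1 / (t - t₀) ^ 2) = K * (1 / (p - t₀) - 1 / (q - t₀)) := by
    rw [intervalIntegral.integral_const_mul]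
    congr 1
    have := intervalIntegral.integral_eq_sub_of_hasDerivAt (a := p) (b := q)
      (f := fun t => -(1 / (t - t₀))) (f' := fun t => 1 / (t - t₀) ^ 2) (fun t ht => by
        have h0 := hsq t (hIcc ▸ ht)
        have := (((hasDerivAt_id t).sub_const t₀).inv h0).neg
        simp only [id] at this
        convert this using 1
        · ext; simp
        · field_simp) (ContinuousOn.intervalIntegrable (by
          rw [hIcc]
          apply ContinuousOn.div continuousOn_const (by fun_prop)
          intro t ht; exact pow_ne_zero _ (hsq t ht)))
    rw [this]; ring
  have hI : ‖∫ t in p..q, u' t * Complex.exp (h t)‖ ≤ K * (2 / δ) := by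
    have h1 := intervalIntegral.norm_integral_le_of_norm_le (a := p) (b := q)
      (f := fun t => u' t * Complex.exp (h t)) (g := fun t => K * (1 / (t - t₀) ^ 2)) (μ := volume) hpq
      (Eventually.of_forall fun t ht => hu'b t (Set.Ioc_subset_Icc_self ht))
      (ContinuousOn.intervalIntegrable (by
          rw [hIcc]
          apply ContinuousOn.mul continuousOn_const
          apply ContinuousOn.div continuousOn_const (by fun_prop)
          intro t ht; exact pow_ne_zero _ (hsq t ht)))
    rw [hint] at h1
    refine h1.trans (mul_le_mul_of_nonneg_left ?_ hK0)
    have a1 : |1 / (p - t₀)| ≤ 1 / δ := by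
      rw [abs_div, abs_one]; exact one_div_le_one_div_of_le hδ (hdist p hp)
    have a2 : |1 / (q - t₀)| ≤ 1 / δ := by
      rw [abs_div, abs_one]; exact one_div_le_one_div_of_le hδ (hdist q hq)
    have := abs_le.mp a1
    have := abs_le.mp a2
    have e : 2 / δ = 1 / δ + 1 / δ := by ring
    linarith
  rw [heq, ibp]
  calc _ ≤ ‖A q / h₁ q * Complex.exp (h q) - A p / h₁ p * Complex.exp (h p)‖
        + ‖∫ t in p..q, u' t * Complex.exp (h t)‖ := norm_sub_le _ _
    _ ≤ (1 / δ * (B / m) + 1 / δ * (B / m)) + K * (2 / δ) :=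
        add_le_add ((norm_sub_le _ _).trans (add_le_add (hend q hq) (hend p hp))) hI
    _ = _ := by rw [hK]; ring

/-- The first derivative test with stationary point 0. The bound depends neither on the length of
the interval nor on a positive lower bound for `Re b`, so it survives both limits taken below. -/
lemma gaussian_tail_le {b : ℂ} (hb : 0 ≤ b.re) (hb0 : b ≠ 0) {p q δ : ℝ} (hpq : p ≤ q) (hδ : 0 < δ)
    (hd : ∀ t ∈ Set.Icc p q, δ ≤ |t|) :
    ‖∫ t in p..q, Complex.exp (-b * (t : ℂ) ^ 2)‖ ≤ 2 / (‖b‖ * δ) := by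
  have hbn : 0 < ‖b‖ := norm_pos_iff.mpr hb0
  have := norm_integral_exp_mul_le (p := p) (q := q) (δ := δ) (t₀ := 0) (m := 2 * ‖b‖) (M := 2 * ‖b‖)
    (B := 1) (B₁ := 0) (h := fun t => -b * (t : ℂ) ^ 2) (h₁ := fun t => -b * (2 * (t : ℂ)))
    (h₂ := fun _ => -b * 2) (A := fun _ => 1) (A₁ := fun _ => 0) hpq hδ (by positivity)
    (by simpa using hd)
    (fun t => by
      have := (((hasDerivAt_id (t : ℂ)).pow 2).const_mul (-b)).comp_ofReal
      simpa using this)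
    (fun t => by
      have := ((((hasDerivAt_id (t : ℂ)).const_mul 2)).const_mul (-b)).comp_ofReal
      simpa using this)
    (fun t => hasDerivAt_const _ _) (by fun_prop) (by fun_prop)
    (fun t => by
      have : (-b * (t : ℂ) ^ 2).re = - b.re * t ^ 2 := by
        rw [← Complex.ofReal_pow, Complex.re_mul_ofReal]; simp
      rw [this]; nlinarith [sq_nonneg t])
    (fun t _ => by simp [mul_comm, mul_left_comm]) (fun t _ => by simp [mul_comm])
    (fun t _ => by simp) (fun t _ => by simp)
  simp only [mul_one] at this
  refine this.trans (le_of_eq ?_)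
  field_simp
  ring

/-- The error consists of two tails, each at most `2 / (‖b‖ δ)`; the full integral is the limit of
symmetric intervals. -/
lemma gaussian_truncation {b : ℂ} (hb : 0 < b.re) {δ : ℝ} (hδ : 0 < δ) :
    ‖(∫ t in (-δ)..δ, Complex.exp (-b * (t : ℂ) ^ 2)) - ((Real.pi : ℂ) / b) ^ (1 / 2 : ℂ)‖
      ≤ 4 / (‖b‖ * δ) := by
  have hb0 : b ≠ 0 := by rintro rfl; simp at hb
  have hi := integrable_cexp_neg_mul_sq hb
  rw [← integral_gaussian_complex hb]
  have hlim : Tendsto (fun T : ℝ => (∫ t in (-δ)..δ, Complex.exp (-b * (t : ℂ) ^ 2))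
      - ∫ t in (-T)..T, Complex.exp (-b * (t : ℂ) ^ 2)) atTop
      (𝓝 ((∫ t in (-δ)..δ, Complex.exp (-b * (t : ℂ) ^ 2))
        - ∫ t : ℝ, Complex.exp (-b * (t : ℂ) ^ 2))) :=
    tendsto_const_nhds.sub
      (intervalIntegral_tendsto_integral hi tendsto_neg_atTop_atBot tendsto_id)
  refine le_of_tendsto hlim.norm ?_
  filter_upwards [eventually_ge_atTop δ] with T hT
  have hii : ∀ x y : ℝ, IntervalIntegrable (fun t : ℝ => Complex.exp (-b * (t : ℂ) ^ 2)) volume x y :=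
    fun x y => hi.intervalIntegrable
  rw [← intervalIntegral.integral_add_adjacent_intervals (hii (-T) (-δ)) (hii (-δ) T),
    ← intervalIntegral.integral_add_adjacent_intervals (hii (-δ) δ) (hii δ T)]
  have h1 := gaussian_tail_le hb.le hb0 (p := -T) (q := -δ) (by linarith) hδ (fun t ht => by
    rw [abs_of_nonpos (by linarith [ht.2])]; linarith [ht.2])
  have h2 := gaussian_tail_le hb.le hb0 (p := δ) (q := T) hT hδ (fun t ht => by
    rw [abs_of_nonneg (by linarith [ht.1])]; linarith [ht.1])
  set I1 := ∫ t in (-T)..(-δ), Complex.exp (-b * (t : ℂ) ^ 2)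
  set I2 := ∫ t in δ..T, Complex.exp (-b * (t : ℂ) ^ 2)
  set I0 := ∫ t in (-δ)..δ, Complex.exp (-b * (t : ℂ) ^ 2)
  have e : I0 - (I1 + (I0 + I2)) = -(I1 + I2) := by ring
  rw [e, norm_neg]
  refine (norm_add_le _ _).trans ((add_le_add h1 h2).trans (le_of_eq ?_))
  ring

/-- The truncated Fresnel integral. -/
lemma fresnel_truncation {l δ : ℝ} (hl : 0 < l) (hδ : 0 < δ) :
    ‖(∫ t in (-δ)..δ, Complex.exp (Complex.I * (l * t ^ 2 / 2 : ℝ)))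
      - (2 * Real.pi * Complex.I / l) ^ (1 / 2 : ℂ)‖ ≤ 8 / (l * δ) := by
  have hl' : (l : ℂ) ≠ 0 := by exact_mod_cast hl.ne'
  -- The Fresnel integrand is the boundary case `Re b = 0`. It is reached from `Re b = ε > 0`, with
  -- a truncation error that stays bounded as `ε → 0`.
  set b : ℝ → ℂ := fun ε => ε - Complex.I * l / 2 with hb
  have hbt : Tendsto b (𝓝[>] 0) (𝓝 (-(Complex.I * l / 2))) := by
    have : Continuous b := by fun_prop
    have := this.tendsto 0
    simp only [hb, Complex.ofReal_zero, zero_sub] at this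
    exact this.mono_left nhdsWithin_le_nhds
  have hbz : -(Complex.I * l / 2) ≠ 0 := by simp [hl']
  have hdiv : (Real.pi : ℂ) / (-(Complex.I * l / 2)) = 2 * Real.pi * Complex.I / l := by
    have hI := Complex.I_ne_zero
    field_simp
    rw [Complex.I_sq]
  -- The limit `2πi/l` lies off the branch cut, so the complex power passes to the limit.
  have hslit : (2 * Real.pi * Complex.I / l : ℂ) ∈ Complex.slitPlane := by
    right
    have : (2 * Real.pi * Complex.I / l : ℂ) = ((2 * Real.pi / l : ℝ) : ℂ) * Complex.I := by
      push_cast; ring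
    rw [this, Complex.im_ofReal_mul]
    have := Real.pi_pos
    simp only [Complex.I_im, mul_one]
    positivity
  have hpow : Tendsto (fun ε => ((Real.pi : ℂ) / b ε) ^ (1 / 2 : ℂ)) (𝓝[>] 0)
      (𝓝 ((2 * Real.pi * Complex.I / l) ^ (1 / 2 : ℂ))) := by
    have h1 : Tendsto (fun ε => (Real.pi : ℂ) / b ε) (𝓝[>] 0) (𝓝 (2 * Real.pi * Complex.I / l)) := by
      rw [← hdiv]; exact tendsto_const_nhds.div hbt hbz
    exact h1.cpow tendsto_const_nhds hslit
  have hint : Tendsto (fun ε => ∫ t in (-δ)..δ, Complex.exp (-(b ε) * (t : ℂ) ^ 2)) (𝓝[>] 0)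
      (𝓝 (∫ t in (-δ)..δ, Complex.exp (Complex.I * (l * t ^ 2 / 2 : ℝ)))) := by
    have hc : Continuous fun ε : ℝ => ∫ t in (-δ)..δ, Complex.exp (-(b ε) * (t : ℂ) ^ 2) := by
      apply intervalIntegral.continuous_parametric_intervalIntegral_of_continuous'
      simp only [Function.uncurry_def, hb]
      fun_prop
    have := (hc.tendsto 0).mono_left (nhdsWithin_le_nhds (s := Set.Ioi 0))
    convert this using 3
    ext t
    congr 1
    simp only [hb]; push_cast; ring
  have hrhs : Tendsto (fun ε => 4 / (‖b ε‖ * δ)) (𝓝[>] 0) (𝓝 (4 / (‖-(Complex.I * l / 2)‖ * δ))) :=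
    tendsto_const_nhds.div (hbt.norm.mul tendsto_const_nhds)
      (mul_pos (norm_pos_iff.mpr hbz) hδ).ne'
  refine (le_of_tendsto_of_tendsto (hint.sub hpow).norm hrhs ?_).trans ?_
  · filter_upwards [self_mem_nhdsWithin] with ε hε
    refine gaussian_truncation ?_ hδ
    simpa [hb] using hε
  · have : ‖-(Complex.I * (l : ℂ) / 2)‖ = l / 2 := by
      simp [abs_of_pos hl]
    rw [this]
    apply le_of_eq; field_simp; norm_num

lemma norm_exp_I_sub_exp_I_le (x y : ℝ) :
    ‖Complex.exp (Complex.I * x) - Complex.exp (Complex.I * y)‖ ≤ |x - y| := by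
  have e : Complex.exp (Complex.I * x) - Complex.exp (Complex.I * y)
      = Complex.exp (Complex.I * y) * (Complex.exp (Complex.I * (x - y : ℝ)) - 1) := by
    rw [mul_sub, ← Complex.exp_add, mul_one]; push_cast; ring_nf
  rw [e, norm_mul, mul_comm Complex.I (y : ℂ), Complex.norm_exp_ofReal_mul_I, one_mul]
  exact Real.norm_exp_I_mul_ofReal_sub_one_le

lemma norm_exp_I_ofReal (x : ℝ) : ‖Complex.exp (Complex.I * x)‖ = 1 := by
  rw [mul_comm, Complex.norm_exp_ofReal_mul_I]

/-- Second order Taylor expansion with a remainder bound of third order. -/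
lemma taylor_two_bound {f f₁ f₂ f₃ : ℝ → ℝ} {M α β k₀ k δ : ℝ}
    (hf : ∀ t, HasDerivAt f (f₁ t) t) (hf₁ : ∀ t, HasDerivAt f₁ (f₂ t) t)
    (hf₂ : ∀ t, HasDerivAt f₂ (f₃ t) t) (hM : ∀ t ∈ Set.Icc α β, |f₃ t| ≤ M) (hδ : 0 ≤ δ)
    (hα : α ≤ k₀ - δ) (hβ : k₀ + δ ≤ β) (hk : |k - k₀| ≤ δ) :
    |f k - f k₀ - f₁ k₀ * (k - k₀) - f₂ k₀ * (k - k₀) ^ 2 / 2| ≤ M * δ ^ 3 := by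
  have hM0 : 0 ≤ M := (abs_nonneg _).trans (hM α ⟨le_rfl, by linarith⟩)
  have hs : Convex ℝ (Set.Icc (k₀ - δ) (k₀ + δ)) := convex_Icc _ _
  have hk0 : k₀ ∈ Set.Icc (k₀ - δ) (k₀ + δ) := ⟨by linarith, by linarith⟩
  have habs : ∀ t ∈ Set.Icc (k₀ - δ) (k₀ + δ), |t - k₀| ≤ δ := fun t ht =>
    abs_le.mpr ⟨by linarith [ht.1], by linarith [ht.2]⟩
  -- The mean value inequality, used three times. Each use costs a factor `δ`, which gives `M δ³`
  -- without the factor 1/6.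
  have step : ∀ {g g' : ℝ → ℝ} {L : ℝ}, 0 ≤ L → (∀ t, HasDerivAt g (g' t) t) →
      (∀ t ∈ Set.Icc (k₀ - δ) (k₀ + δ), |g' t| ≤ L) →
      ∀ t ∈ Set.Icc (k₀ - δ) (k₀ + δ), |g t - g k₀| ≤ L * δ := by
    intro g g' L hL hg hb t ht
    have := hs.norm_image_sub_le_of_norm_hasDerivWithin_le
      (fun x _ => (hg x).hasDerivWithinAt) hb hk0 ht
    exact this.trans (mul_le_mul_of_nonneg_left (habs t ht) hL)
  have h2 : ∀ t ∈ Set.Icc (k₀ - δ) (k₀ + δ), |f₂ t - f₂ k₀| ≤ M * δ :=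
    step hM0 hf₂ fun t ht => hM t ⟨by linarith [ht.1], by linarith [ht.2]⟩
  have h1 := step (g := fun t => f₁ t - f₂ k₀ * (t - k₀)) (g' := fun t => f₂ t - f₂ k₀)
    (L := M * δ) (by positivity)
    (fun t => by
      have := (hf₁ t).fun_sub (((hasDerivAt_id' t).sub_const k₀).const_mul (f₂ k₀))
      rwa [mul_one] at this) h2
  have h0 := step (g := fun t => f t - f₁ k₀ * (t - k₀) - f₂ k₀ * (t - k₀) ^ 2 / 2)
    (g' := fun t => f₁ t - f₁ k₀ - f₂ k₀ * (t - k₀)) (L := M * δ * δ) (by positivity)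
    (fun t => by
      have := ((hf t).fun_sub (((hasDerivAt_id' t).sub_const k₀).const_mul (f₁ k₀))).fun_sub
        ((((((hasDerivAt_id' t).sub_const k₀)).fun_pow 2).const_mul (f₂ k₀)).div_const 2)
      exact this.congr_deriv (by push_cast; ring))
    (fun t ht => by
      have := h1 t ht
      simp only [sub_self, mul_zero, sub_zero] at this
      refine (le_of_eq (congrArg abs ?_)).trans this
      ring)
  have := h0 k ⟨by linarith [(abs_le.mp hk).1], by linarith [(abs_le.mp hk).2]⟩
  simp only [sub_self, mul_zero, sub_zero] at this
  refine le_trans (le_of_eq ?_) (this.trans (le_of_eq ?_))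
  · congr 1; simp; ring
  · ring

/-- Stationary phase with an error estimate that is uniform in the stationary point. -/
lemma stationary_phase {f f₁ f₂ f₃ : ℝ → ℝ} {A A₁ : ℝ → ℂ} {α β c ρ : ℝ} {K : Set ℝ}
    (hf : ∀ t, HasDerivAt f (f₁ t) t) (hf₁ : ∀ t, HasDerivAt f₁ (f₂ t) t)
    (hf₂ : ∀ t, HasDerivAt f₂ (f₃ t) t) (hf₃ : Continuous f₃)
    (hA : ∀ t, HasDerivAt A (A₁ t) t) (hA₁ : Continuous A₁) (hc : 0 < c) (hαβ : α ≤ β)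
    (hK : ∀ k₀ ∈ K, α + ρ ≤ k₀ ∧ k₀ + ρ ≤ β)
    (hlow : ∀ k₀ ∈ K, ∀ k ∈ Set.Icc α β, c * |k - k₀| ≤ |f₁ k - f₁ k₀|)
    (hlow₂ : ∀ k₀ ∈ K, c ≤ f₂ k₀) :
    ∃ D : ℝ, ∀ l δ : ℝ, 0 < l → 0 < δ → δ ≤ ρ → ∀ k₀ ∈ K,
      ‖(∫ k in α..β, Complex.exp (Complex.I * (l * (f k - f₁ k₀ * k) : ℝ)) * A k)
        - Complex.exp (Complex.I * (l * (f k₀ - f₁ k₀ * k₀) : ℝ)) * A k₀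
          * (2 * Real.pi * Complex.I / (l * f₂ k₀ : ℝ)) ^ (1 / 2 : ℂ)‖
        ≤ D * (l * δ ^ 4 + δ ^ 2 + 1 / (l * δ)) := by
  have hfc : Continuous f := continuous_iff_continuousAt.mpr fun t => (hf t).continuousAt
  have hf₁c : Continuous f₁ := continuous_iff_continuousAt.mpr fun t => (hf₁ t).continuousAt
  have hf₂c : Continuous f₂ := continuous_iff_continuousAt.mpr fun t => (hf₂ t).continuousAt
  have hAc : Continuous A := continuous_iff_continuousAt.mpr fun t => (hA t).continuousAt
  have hcpt : IsCompact (Set.Icc α β) := isCompact_Icc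
  obtain ⟨M₂, hM₂⟩ := hcpt.exists_bound_of_continuousOn hf₂c.continuousOn
  obtain ⟨M₃, hM₃⟩ := hcpt.exists_bound_of_continuousOn hf₃.continuousOn
  obtain ⟨B, hB⟩ := hcpt.exists_bound_of_continuousOn hAc.continuousOn
  obtain ⟨B₁, hB₁⟩ := hcpt.exists_bound_of_continuousOn hA₁.continuousOn
  have hαm : α ∈ Set.Icc α β := ⟨le_rfl, hαβ⟩
  have hM₂0 := (norm_nonneg _).trans (hM₂ α hαm)
  have hM₃0 := (norm_nonneg _).trans (hM₃ α hαm)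
  have hB0 := (norm_nonneg _).trans (hB α hαm)
  have hB₁0 := (norm_nonneg _).trans (hB₁ α hαm)
  have hL : 0 ≤ β - α := by linarith
  set T := 2 * (B / c + B₁ * (β - α) / c + B * M₂ / c ^ 2) with hT
  have hT0 : 0 ≤ T := by positivity
  -- All constants come from bounds on `[α, β]`, hence not from `k₀`. The Taylor remainder of the
  -- phase gives `l δ⁴`, the variation of the amplitude `δ²`, and the tails with the Fresnel
  -- truncation `1 / (l δ)`.
  refine ⟨2 * T + 2 * B₁ + 2 * M₃ * B + B * 8 / c, fun l δ hl hδ hδρ k₀ hk₀ => ?_⟩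
  obtain ⟨hk1, hk2⟩ := hK k₀ hk₀
  have hk0I : k₀ ∈ Set.Icc α β := ⟨by linarith, by linarith⟩
  set F : ℝ → ℂ := fun k => Complex.exp (Complex.I * (l * (f k - f₁ k₀ * k) : ℝ)) * A k with hF
  have hFc : Continuous F := by simp only [hF]; fun_prop
  have tail : ∀ p q, p ≤ q → Set.Icc p q ⊆ Set.Icc α β → (∀ t ∈ Set.Icc p q, δ ≤ |t - k₀|) →
      ‖∫ k in p..q, F k‖ ≤ T * (1 / (l * δ)) := by
    intro p q hpq hsub hd
    have := norm_integral_exp_mul_le (p := p) (q := q) (δ := δ) (t₀ := k₀) (m := l * c)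
      (M := l * M₂) (B := B) (B₁ := B₁ * (β - α))
      (h := fun k => Complex.I * (l * (f k - f₁ k₀ * k) : ℝ))
      (h₁ := fun k => Complex.I * (l * (f₁ k - f₁ k₀) : ℝ))
      (h₂ := fun k => Complex.I * (l * f₂ k : ℝ)) (A := A) (A₁ := A₁) hpq hδ (by positivity) hd
      (fun t => by
        have := (((hf t).sub ((hasDerivAt_id t).const_mul (f₁ k₀))).const_mul l).ofReal_comp.const_mul
          Complex.I
        simpa using this)
      (fun t => by
        have := (((hf₁ t).sub_const (f₁ k₀)).const_mul l).ofReal_comp.const_mul Complex.I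
        simpa using this)
      hA (by fun_prop) hA₁
      (fun t => by simp)
      (fun t ht => by
        have := hlow k₀ hk₀ t (hsub ht)
        rw [norm_mul, Complex.norm_I, one_mul, Complex.norm_real, Real.norm_eq_abs, abs_mul,
          abs_of_pos hl, mul_assoc]
        exact mul_le_mul_of_nonneg_left this hl.le)
      (fun t ht => by
        rw [norm_mul, Complex.norm_I, one_mul, Complex.norm_real, norm_mul, Real.norm_eq_abs l,
          abs_of_pos hl]
        exact mul_le_mul_of_nonneg_left (hM₂ t (hsub ht)) hl.le)
      (fun t ht => hB t (hsub ht))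
      (fun t ht => mul_le_mul (hB₁ t (hsub ht)) (by
        have := hsub ht
        exact abs_le.mpr ⟨by linarith [this.1, hk0I.2], by linarith [this.2, hk0I.1]⟩)
        (abs_nonneg _) hB₁0)
    refine this.trans (le_of_eq ?_)
    rw [hT]; field_simp
  have t1 := tail α (k₀ - δ) (by linarith) (Set.Icc_subset_Icc le_rfl (by linarith)) fun t ht => by
    rw [abs_of_nonpos (by linarith [ht.2])]; linarith [ht.2]
  have t2 := tail (k₀ + δ) β (by linarith) (Set.Icc_subset_Icc (by linarith) le_rfl) fun t ht => by
    rw [abs_of_nonneg (by linarith [ht.1])]; linarith [ht.1]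
  set E₀ := Complex.exp (Complex.I * (l * (f k₀ - f₁ k₀ * k₀) : ℝ)) with hE₀
  set G : ℝ → ℂ := fun t => Complex.exp (Complex.I * (l * f₂ k₀ * t ^ 2 / 2 : ℝ)) with hG
  have hGc : Continuous G := by simp only [hG]; fun_prop
  have shift : ∫ k in (k₀ - δ)..(k₀ + δ), E₀ * A k₀ * G (k - k₀) = E₀ * A k₀ * ∫ t in (-δ)..δ, G t := by
    rw [intervalIntegral.integral_const_mul, intervalIntegral.integral_comp_sub_right]
    congr 2 <;> ring
  -- Near `k₀` the amplitude is frozen and the phase replaced by its quadratic Taylor polynomial;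
  -- the last factor `2 * δ` is the length of the interval.
  have center : ‖(∫ k in (k₀ - δ)..(k₀ + δ), F k) - E₀ * A k₀ * ∫ t in (-δ)..δ, G t‖
      ≤ (B₁ * δ + l * (M₃ * δ ^ 3) * B) * (2 * δ) := by
    rw [← shift, ← intervalIntegral.integral_sub (hFc.intervalIntegrable _ _)
      ((by fun_prop : Continuous fun k => E₀ * A k₀ * G (k - k₀)).intervalIntegrable _ _)]
    have := intervalIntegral.norm_integral_le_of_norm_le_const (a := k₀ - δ) (b := k₀ + δ)
      (f := fun k => F k - E₀ * A k₀ * G (k - k₀)) (C := B₁ * δ + l * (M₃ * δ ^ 3) * B) (fun k hk => by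
        rw [Set.uIoc_of_le (by linarith)] at hk
        have hkd : |k - k₀| ≤ δ := abs_le.mpr ⟨by linarith [hk.1], by linarith [hk.2]⟩
        have hkI : k ∈ Set.Icc α β := ⟨by linarith [hk.1], by linarith [hk.2]⟩
        have e : F k - E₀ * A k₀ * G (k - k₀)
            = Complex.exp (Complex.I * (l * (f k - f₁ k₀ * k) : ℝ)) * (A k - A k₀)
            + (Complex.exp (Complex.I * (l * (f k - f₁ k₀ * k) : ℝ))
              - Complex.exp (Complex.I * (l * (f k₀ - f₁ k₀ * k₀) + l * f₂ k₀ * (k - k₀) ^ 2 / 2 : ℝ)))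
              * A k₀ := by
          have : E₀ * G (k - k₀) = Complex.exp
              (Complex.I * (l * (f k₀ - f₁ k₀ * k₀) + l * f₂ k₀ * (k - k₀) ^ 2 / 2 : ℝ)) := by
            simp only [hE₀, hG]
            rw [← Complex.exp_add]; push_cast; ring_nf
          rw [← this]; simp only [hF]; ring
        rw [e]
        refine (norm_add_le _ _).trans (add_le_add ?_ ?_)
        · rw [norm_mul, norm_exp_I_ofReal, one_mul]
          have := (convex_Icc α β).norm_image_sub_le_of_norm_hasDerivWithin_le
            (fun x _ => (hA x).hasDerivWithinAt) hB₁ hk0I hkI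
          exact this.trans (mul_le_mul_of_nonneg_left hkd hB₁0)
        · rw [norm_mul]
          refine mul_le_mul ((norm_exp_I_sub_exp_I_le _ _).trans ?_) (hB k₀ hk0I) (norm_nonneg _)
            (by positivity)
          have := taylor_two_bound hf hf₁ hf₂ (α := α) (β := β) (k₀ := k₀) (k := k) hM₃ hδ.le
            (by linarith) (by linarith) hkd
          rw [show l * (f k - f₁ k₀ * k) - (l * (f k₀ - f₁ k₀ * k₀) + l * f₂ k₀ * (k - k₀) ^ 2 / 2)
            = l * (f k - f k₀ - f₁ k₀ * (k - k₀) - f₂ k₀ * (k - k₀) ^ 2 / 2) by ring, abs_mul,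
            abs_of_pos hl]
          exact mul_le_mul_of_nonneg_left this hl.le)
    refine this.trans (le_of_eq ?_)
    rw [show k₀ + δ - (k₀ - δ) = 2 * δ by ring, abs_of_pos (by positivity)]
  have hf2 : c ≤ f₂ k₀ := hlow₂ k₀ hk₀
  have fres := fresnel_truncation (l := l * f₂ k₀) (δ := δ) (mul_pos hl (hc.trans_le hf2)) hδ
  set Φ := (2 * Real.pi * Complex.I / (l * f₂ k₀ : ℝ)) ^ (1 / 2 : ℂ)
  have hE : ‖E₀ * A k₀‖ ≤ B := by
    rw [norm_mul, norm_exp_I_ofReal, one_mul]; exact hB k₀ hk0I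
  have fres' : ‖E₀ * A k₀ * (∫ t in (-δ)..δ, G t) - E₀ * A k₀ * Φ‖ ≤ B * 8 / c * (1 / (l * δ)) := by
    rw [← mul_sub, norm_mul]
    calc _ ≤ B * (8 / (l * f₂ k₀ * δ)) := mul_le_mul hE fres (norm_nonneg _) hB0
      _ ≤ B * (8 / (l * c * δ)) := by gcongr
      _ = _ := by field_simp
  have split : (∫ k in α..β, F k) = (∫ k in α..(k₀ - δ), F k) + (∫ k in (k₀ - δ)..(k₀ + δ), F k)
      + ∫ k in (k₀ + δ)..β, F k := by
    have hi : ∀ x y, IntervalIntegrable F volume x y := fun x y => hFc.intervalIntegrable _ _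
    rw [intervalIntegral.integral_add_adjacent_intervals (hi _ _) (hi _ _),
      intervalIntegral.integral_add_adjacent_intervals (hi _ _) (hi _ _)]
  rw [split]
  set I1 := ∫ k in α..(k₀ - δ), F k
  set I2 := ∫ k in (k₀ - δ)..(k₀ + δ), F k
  set I3 := ∫ k in (k₀ + δ)..β, F k
  set J := ∫ t in (-δ)..δ, G t
  have e : I1 + I2 + I3 - E₀ * A k₀ * Φ
      = I1 + I3 + (I2 - E₀ * A k₀ * J) + (E₀ * A k₀ * J - E₀ * A k₀ * Φ) := by ring
  rw [e]
  have n1 := norm_add_le (I1 + I3 + (I2 - E₀ * A k₀ * J)) (E₀ * A k₀ * J - E₀ * A k₀ * Φ)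
  have n2 := norm_add_le (I1 + I3) (I2 - E₀ * A k₀ * J)
  have n3 := norm_add_le I1 I3
  have hl4 : 0 ≤ l * δ ^ 4 := by positivity
  have hd2 : 0 ≤ δ ^ 2 := by positivity
  have hld : 0 ≤ 1 / (l * δ) := by positivity
  have fin : (B₁ * δ + l * (M₃ * δ ^ 3) * B) * (2 * δ)
      = 2 * B₁ * δ ^ 2 + 2 * M₃ * B * (l * δ ^ 4) := by ring
  have P1 : 0 ≤ 2 * B₁ := by positivity
  have P2 : 0 ≤ 2 * M₃ * B := by positivity
  have P3 : 0 ≤ B * 8 / c := by positivity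
  set X := l * δ ^ 4
  set Y := δ ^ 2
  set Z := 1 / (l * δ)
  rw [fin] at center
  have : (2 * T + 2 * B₁ + 2 * M₃ * B + B * 8 / c) * (X + Y + Z)
    = T * Z + T * Z + (2 * B₁ * Y + 2 * M₃ * B * X) + B * 8 / c * Z + (2 * T * (X + Y)
      + 2 * B₁ * (X + Z) + 2 * M₃ * B * (Y + Z) + B * 8 / c * (X + Y)) := by ring
  have : 0 ≤ (2 * T * (X + Y)
      + 2 * B₁ * (X + Z) + 2 * M₃ * B * (Y + Z) + B * 8 / c * (X + Y)) := by positivity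
  linarith

/-- The error of `stationary_phase` is of smaller order than the leading term. -/
lemma stationary_phase_eventually {f f₁ f₂ f₃ : ℝ → ℝ} {A A₁ : ℝ → ℂ} {α β c ρ : ℝ} {K : Set ℝ}
    (hf : ∀ t, HasDerivAt f (f₁ t) t) (hf₁ : ∀ t, HasDerivAt f₁ (f₂ t) t)
    (hf₂ : ∀ t, HasDerivAt f₂ (f₃ t) t) (hf₃ : Continuous f₃)
    (hA : ∀ t, HasDerivAt A (A₁ t) t) (hA₁ : Continuous A₁) (hc : 0 < c) (hαβ : α ≤ β) (hρ : 0 < ρ)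
    (hK : ∀ k₀ ∈ K, α + ρ ≤ k₀ ∧ k₀ + ρ ≤ β)
    (hlow : ∀ k₀ ∈ K, ∀ k ∈ Set.Icc α β, c * |k - k₀| ≤ |f₁ k - f₁ k₀|)
    (hlow₂ : ∀ k₀ ∈ K, c ≤ f₂ k₀) {ε : ℝ} (hε : 0 < ε) :
    ∀ᶠ n : ℕ in atTop, ∀ k₀ ∈ K,
      √n * ‖(∫ k in α..β, Complex.exp (Complex.I * (n * (f k - f₁ k₀ * k) : ℝ)) * A k)
        - Complex.exp (Complex.I * (n * (f k₀ - f₁ k₀ * k₀) : ℝ)) * A k₀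
          * (2 * Real.pi * Complex.I / (n * f₂ k₀ : ℝ)) ^ (1 / 2 : ℂ)‖ ≤ ε := by
  obtain ⟨D, hD⟩ := stationary_phase hf hf₁ hf₂ hf₃ hA hA₁ hc hαβ hK hlow hlow₂
  have hcast : Tendsto (fun n : ℕ => (n : ℝ)) atTop atTop := tendsto_natCast_atTop_atTop
  -- The choice `δ = n^(-2/5)` makes the three errors `n^(-3/5)`, `n^(-4/5)` and `n^(-3/5)`, all
  -- `o(n^(-1/2))`. Any exponent strictly between 3/8 and 1/2 would serve.
  have h1 : Tendsto (fun n : ℕ => (n : ℝ) ^ (-(2 / 5) : ℝ)) atTop (𝓝 0) :=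
    (tendsto_rpow_neg_atTop (by norm_num)).comp hcast
  have h2 : Tendsto (fun n : ℕ => |D| * (3 * (n : ℝ) ^ (-(1 / 10) : ℝ))) atTop (𝓝 0) := by
    have := ((tendsto_rpow_neg_atTop (y := 1 / 10) (by norm_num)).comp hcast).const_mul 3
      |>.const_mul |D|
    simpa using this
  filter_upwards [h1.eventually_le_const hρ, h2.eventually_le_const hε, eventually_ge_atTop 1]
    with n hn1 hn2 hn3 k₀ hk₀
  have hn : (1 : ℝ) ≤ n := by exact_mod_cast hn3
  have hn0 : (0 : ℝ) < n := by linarith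
  have := hD n ((n : ℝ) ^ (-(2 / 5) : ℝ)) hn0 (by positivity) hn1 k₀ hk₀
  refine (mul_le_mul_of_nonneg_left this (Real.sqrt_nonneg _)).trans (le_trans ?_ hn2)
  have hs : √(n : ℝ) = (n : ℝ) ^ (1 / 2 : ℝ) := Real.sqrt_eq_rpow _
  have e4 : ((n : ℝ) ^ (-(2 / 5) : ℝ)) ^ 4 = (n : ℝ) ^ (-(8 / 5) : ℝ) := by
    rw [← Real.rpow_natCast, ← Real.rpow_mul hn0.le]; norm_num
  have e2 : ((n : ℝ) ^ (-(2 / 5) : ℝ)) ^ 2 = (n : ℝ) ^ (-(4 / 5) : ℝ) := by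
    rw [← Real.rpow_natCast, ← Real.rpow_mul hn0.le]; norm_num
  have a1 : (n : ℝ) * (n : ℝ) ^ (-(8 / 5) : ℝ) = (n : ℝ) ^ (-(3 / 5) : ℝ) := by
    nth_rewrite 1 [← Real.rpow_one (n : ℝ)]
    rw [← Real.rpow_add hn0]; norm_num
  have a3 : 1 / ((n : ℝ) * (n : ℝ) ^ (-(2 / 5) : ℝ)) = (n : ℝ) ^ (-(3 / 5) : ℝ) := by
    nth_rewrite 1 [← Real.rpow_one (n : ℝ)]
    rw [← Real.rpow_add hn0, one_div, ← Real.rpow_neg hn0.le]; norm_num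
  have a2 : (n : ℝ) ^ (-(4 / 5) : ℝ) ≤ (n : ℝ) ^ (-(3 / 5) : ℝ) :=
    Real.rpow_le_rpow_of_exponent_le hn (by norm_num)
  have a0 : (n : ℝ) ^ (1 / 2 : ℝ) * (n : ℝ) ^ (-(3 / 5) : ℝ) = (n : ℝ) ^ (-(1 / 10) : ℝ) := by
    rw [← Real.rpow_add hn0]; norm_num
  rw [e4, e2, a1, a3, hs]
  calc (n : ℝ) ^ (1 / 2 : ℝ) * (D * ((n : ℝ) ^ (-(3 / 5) : ℝ) + (n : ℝ) ^ (-(4 / 5) : ℝ)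
        + (n : ℝ) ^ (-(3 / 5) : ℝ)))
      ≤ (n : ℝ) ^ (1 / 2 : ℝ) * (|D| * (3 * (n : ℝ) ^ (-(3 / 5) : ℝ))) := by
        apply mul_le_mul_of_nonneg_left _ (by positivity)
        exact mul_le_mul (le_abs_self D) (by linarith) (by positivity) (abs_nonneg _)
    _ = |D| * (3 * ((n : ℝ) ^ (1 / 2 : ℝ) * (n : ℝ) ^ (-(3 / 5) : ℝ))) := by ring
    _ = _ := by rw [a0]

/-! ### The dispersion relation and its inverse group velocity -/

/-- The sine of the quasi-energy. -/
def sinE (a k : ℝ) : ℝ := √(1 - (a * Real.cos k) ^ 2)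

/-- The dispersion relation `cos ω(k) = a cos k` of the walk. -/
def energy (a k : ℝ) : ℝ := Real.arccos (a * Real.cos k)

/-- The group velocity `ω'`. -/
def vel (a k : ℝ) : ℝ := a * Real.sin k / sinE a k

/-- The second derivative `ω''`. -/
def acc (a k : ℝ) : ℝ := a * (1 - a ^ 2) * Real.cos k / sinE a k ^ 3

/-- The third derivative `ω'''`. -/
def jerk (a k : ℝ) : ℝ :=
  (a * (1 - a ^ 2) * (-Real.sin k) * sinE a k ^ 3
    - a * (1 - a ^ 2) * Real.cos k
      * (3 * sinE a k ^ 2 * (a ^ 2 * Real.cos k * Real.sin k / sinE a k))) / (sinE a k ^ 3) ^ 2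

/-- The wave number at which the group velocity is `s`. -/
def waveNumber (a s : ℝ) : ℝ := Real.arcsin (s * √(1 - a ^ 2) / (a * √(1 - s ^ 2)))

section dispersion

variable {a : ℝ}

lemma sq_mul_cos_lt_one (ha : 0 < a) (ha1 : a < 1) (k : ℝ) : (a * Real.cos k) ^ 2 < 1 := by
  have h1 : Real.cos k ^ 2 ≤ 1 := Real.cos_sq_le_one k
  rw [mul_pow]; nlinarith [sq_nonneg (Real.cos k)]

lemma sinE_pos (ha : 0 < a) (ha1 : a < 1) (k : ℝ) : 0 < sinE a k :=
  Real.sqrt_pos.mpr (by linarith [sq_mul_cos_lt_one ha ha1 k])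

lemma sinE_sq (ha : 0 < a) (ha1 : a < 1) (k : ℝ) :
    sinE a k ^ 2 = 1 - a ^ 2 + a ^ 2 * Real.sin k ^ 2 := by
  rw [sinE, Real.sq_sqrt (by linarith [sq_mul_cos_lt_one ha ha1 k]), mul_pow, Real.cos_sq']
  ring

lemma sinE_le_one (k : ℝ) : sinE a k ≤ 1 := by
  rw [sinE, Real.sqrt_le_iff]; refine ⟨zero_le_one, ?_⟩; nlinarith [sq_nonneg (a * Real.cos k)]

lemma hasDerivAt_sinE (ha : 0 < a) (ha1 : a < 1) (k : ℝ) :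
    HasDerivAt (sinE a) (a ^ 2 * Real.cos k * Real.sin k / sinE a k) k := by
  have h := ((((Real.hasDerivAt_cos k).const_mul a).fun_pow 2).const_sub 1).sqrt
    (by linarith [sq_mul_cos_lt_one ha ha1 k])
  refine h.congr_deriv ?_
  have := sinE_pos ha ha1 k
  rw [sinE] at *
  field_simp
  push_cast
  ring

lemma hasDerivAt_energy (ha : 0 < a) (ha1 : a < 1) (k : ℝ) :
    HasDerivAt (energy a) (vel a k) k := by
  have h1 := (sq_lt_one_iff_abs_lt_one _).mp (sq_mul_cos_lt_one ha ha1 k)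
  have h := (Real.hasDerivAt_arccos (abs_lt.mp h1).1.ne' (abs_lt.mp h1).2.ne).comp k
    ((Real.hasDerivAt_cos k).const_mul a)
  refine h.congr_deriv ?_
  have := sinE_pos ha ha1 k
  rw [vel]; rw [sinE] at *
  field_simp

lemma hasDerivAt_vel (ha : 0 < a) (ha1 : a < 1) (k : ℝ) :
    HasDerivAt (vel a) (acc a k) k := by
  have hS := sinE_pos ha ha1 k
  have h := ((Real.hasDerivAt_sin k).const_mul a).fun_div (hasDerivAt_sinE ha ha1 k) hS.ne'
  refine h.congr_deriv ?_
  rw [acc]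
  field_simp
  rw [sinE_sq ha ha1 k]
  ring

lemma hasDerivAt_acc (ha : 0 < a) (ha1 : a < 1) (k : ℝ) :
    HasDerivAt (acc a) (jerk a k) k := by
  have hS := sinE_pos ha ha1 k
  have h := ((Real.hasDerivAt_cos k).const_mul (a * (1 - a ^ 2))).fun_div
    ((hasDerivAt_sinE ha ha1 k).fun_pow 3) (pow_ne_zero 3 hS.ne')
  refine h.congr_deriv ?_
  rw [jerk]
  norm_num

lemma continuous_sinE : Continuous (sinE a) := by
  unfold sinE; fun_prop

lemma continuous_energy : Continuous (energy a) := by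
  unfold energy; fun_prop

lemma continuous_vel (ha : 0 < a) (ha1 : a < 1) : Continuous (vel a) := by
  have := continuous_sinE (a := a)
  unfold vel
  exact Continuous.div (by fun_prop) this fun k => (sinE_pos ha ha1 k).ne'

lemma continuous_acc (ha : 0 < a) (ha1 : a < 1) : Continuous (acc a) := by
  have := continuous_sinE (a := a)
  unfold acc
  exact Continuous.div (by fun_prop) (this.pow 3) fun k => pow_ne_zero _ (sinE_pos ha ha1 k).ne'

lemma continuous_jerk (ha : 0 < a) (ha1 : a < 1) : Continuous (jerk a) := by
  have := continuous_sinE (a := a)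
  have h2 : Continuous fun k => a ^ 2 * Real.cos k * Real.sin k / sinE a k :=
    Continuous.div (by fun_prop) this fun k => (sinE_pos ha ha1 k).ne'
  unfold jerk
  exact Continuous.div (by fun_prop) (by fun_prop)
    fun k => pow_ne_zero _ (pow_ne_zero _ (sinE_pos ha ha1 k).ne')

lemma acc_pos (ha : 0 < a) (ha1 : a < 1) {k : ℝ} (hk : k ∈ Set.Ioo (-(Real.pi / 2)) (Real.pi / 2)) :
    0 < acc a k := by
  have := sinE_pos ha ha1 k
  have := Real.cos_pos_of_mem_Ioo hk
  have : 0 < 1 - a ^ 2 := by nlinarith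
  unfold acc; positivity

lemma abs_vel_lt (ha : 0 < a) (ha1 : a < 1) (k : ℝ) : |vel a k| < 1 := by
  have hS := sinE_pos ha ha1 k
  rw [vel, abs_div, abs_of_pos hS, div_lt_one hS]
  apply abs_lt_of_sq_lt_sq _ hS.le
  rw [sinE_sq ha ha1, mul_pow]; nlinarith

lemma one_sub_vel_sq (ha : 0 < a) (ha1 : a < 1) (k : ℝ) :
    1 - vel a k ^ 2 = (1 - a ^ 2) / sinE a k ^ 2 := by
  have hS := sinE_pos ha ha1 k
  rw [vel]; field_simp
  rw [sinE_sq ha ha1]; ring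

/-- After squaring, `s² (1 - a²) < a² (1 - s²)` is just `s² < a²`. -/
lemma waveNumber_arg (ha : 0 < a) (ha1 : a < 1) {s : ℝ} (hs : |s| < a) :
    |s * √(1 - a ^ 2) / (a * √(1 - s ^ 2))| < 1 := by
  have hs2 : s ^ 2 < a ^ 2 := sq_lt_sq' (abs_lt.mp hs).1 (abs_lt.mp hs).2
  have ha2 : a ^ 2 < 1 := by nlinarith
  have h1 : 0 < √(1 - s ^ 2) := Real.sqrt_pos.mpr (by linarith)
  have h2 : 0 < a * √(1 - s ^ 2) := by positivity
  rw [abs_div, abs_of_pos h2, div_lt_one h2]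
  apply abs_lt_of_sq_lt_sq _ h2.le
  rw [mul_pow, mul_pow, Real.sq_sqrt (by linarith), Real.sq_sqrt (by linarith)]
  nlinarith

lemma waveNumber_mem (ha : 0 < a) (ha1 : a < 1) {s : ℝ} (hs : |s| < a) :
    waveNumber a s ∈ Set.Ioo (-(Real.pi / 2)) (Real.pi / 2) := by
  have := abs_lt.mp (waveNumber_arg ha ha1 hs)
  exact ⟨Real.neg_pi_div_two_lt_arcsin.mpr this.1, Real.arcsin_lt_pi_div_two.mpr this.2⟩

lemma vel_waveNumber (ha : 0 < a) (ha1 : a < 1) {s : ℝ} (hs : |s| < a) :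
    vel a (waveNumber a s) = s := by
  have harg := abs_lt.mp (waveNumber_arg ha ha1 hs)
  have hs2 : s ^ 2 < a ^ 2 := sq_lt_sq' (abs_lt.mp hs).1 (abs_lt.mp hs).2
  have ha2 : a ^ 2 < 1 := by nlinarith
  have hsin : Real.sin (waveNumber a s) = s * √(1 - a ^ 2) / (a * √(1 - s ^ 2)) :=
    Real.sin_arcsin harg.1.le harg.2.le
  have h1 : 0 < √(1 - s ^ 2) := Real.sqrt_pos.mpr (by linarith)
  have h2 : 0 < √(1 - a ^ 2) := Real.sqrt_pos.mpr (by linarith)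
  have hS : sinE a (waveNumber a s) = √(1 - a ^ 2) / √(1 - s ^ 2) := by
    apply (sq_eq_sq₀ (sinE_pos ha ha1 _).le (by positivity)).mp
    rw [sinE_sq ha ha1, hsin]
    rw [div_pow, div_pow, mul_pow, mul_pow, Real.sq_sqrt (by linarith), Real.sq_sqrt (by linarith)]
    have : 1 - s ^ 2 ≠ 0 := by linarith
    field_simp; ring
  rw [vel, hS, hsin]
  field_simp

lemma waveNumber_zero_iff (ha : 0 < a) (ha1 : a < 1) {s : ℝ} (hs : |s| < a) :
    waveNumber a s = 0 ↔ s = 0 := by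
  constructor
  · intro h
    have := vel_waveNumber ha ha1 hs
    rw [h] at this
    simpa [vel] using this.symm
  · rintro rfl; simp [waveNumber]

lemma contDiffAt_waveNumber (ha : 0 < a) (ha1 : a < 1) {s : ℝ} (hs : |s| < a) :
    ContDiffAt ℝ 1 (waveNumber a) s := by
  have harg := abs_lt.mp (waveNumber_arg ha ha1 hs)
  have hs2 : s ^ 2 < a ^ 2 := sq_lt_sq' (abs_lt.mp hs).1 (abs_lt.mp hs).2
  have ha2 : a ^ 2 < 1 := by nlinarith
  have h1 : 0 < √(1 - s ^ 2) := Real.sqrt_pos.mpr (by linarith)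
  refine ContDiffAt.comp (g := Real.arcsin)
    (f := fun s => s * √(1 - a ^ 2) / (a * √(1 - s ^ 2))) s
    (Real.contDiffAt_arcsin harg.1.ne' harg.2.ne) ?_
  apply ContDiffAt.div
  · fun_prop
  · apply ContDiffAt.mul contDiffAt_const
    apply ContDiffAt.sqrt (by fun_prop)
    linarith
  · positivity

lemma continuousOn_waveNumber (ha : 0 < a) (ha1 : a < 1) :
    ContinuousOn (waveNumber a) (Set.Ioo (-a) a) := fun _ hs =>
  (contDiffAt_waveNumber ha ha1 (abs_lt.mpr hs)).continuousAt.continuousWithinAt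

lemma measurable_waveNumber : Measurable (waveNumber a) := by
  unfold waveNumber
  exact Real.continuous_arcsin.measurable.comp (by fun_prop)

/-- Sum-to-product: the half difference is handled by `2x/π ≤ sin x`, and the half sum stays at most
`(π/2 + k₁)/2 < π/2` in modulus, so its cosine is bounded below. -/
lemma sin_sub_sin_lower {k₁ k₀ k : ℝ} (hk₁ : k₁ < Real.pi / 2) (h0 : |k₀| ≤ k₁)
    (hk : |k| ≤ Real.pi / 2) (hle : k₀ ≤ k) :
    2 / Real.pi * Real.cos ((Real.pi / 2 + k₁) / 2) * (k - k₀) ≤ Real.sin k - Real.sin k₀ := by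
  have hpi := Real.pi_pos
  have a0 := abs_le.mp h0
  have a1 := abs_le.mp hk
  rw [Real.sin_sub_sin]
  have hs : 2 / Real.pi * ((k - k₀) / 2) ≤ Real.sin ((k - k₀) / 2) :=
    Real.mul_le_sin (by linarith) (by linarith)
  have hc : Real.cos ((Real.pi / 2 + k₁) / 2) ≤ Real.cos ((k + k₀) / 2) := by
    rw [← Real.cos_abs ((k + k₀) / 2)]
    apply Real.cos_le_cos_of_nonneg_of_le_pi (abs_nonneg _) (by linarith)
    exact abs_le.mpr ⟨by linarith, by linarith⟩
  have hc0 : 0 ≤ Real.cos ((Real.pi / 2 + k₁) / 2) :=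
    Real.cos_nonneg_of_neg_pi_div_two_le_of_le (by linarith [(abs_nonneg k₀).trans h0]) (by linarith)
  have hd : 0 ≤ k - k₀ := by linarith
  calc _ = 2 * (2 / Real.pi * ((k - k₀) / 2)) * Real.cos ((Real.pi / 2 + k₁) / 2) := by ring
    _ ≤ _ := mul_le_mul (by linarith) hc hc0
      (mul_nonneg zero_le_two (le_trans (by positivity) hs))

/-- Because `sinE ≤ 1`, the function `vel - a (1 - a²) sin` is increasing, so the bound is inherited
from the sine. It holds up to `±π/2`, where `acc` vanishes, because only one of the two points has
to stay in `[-k₁, k₁]`. -/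
lemma vel_sub_vel_lower (ha : 0 < a) (ha1 : a < 1) {k₁ : ℝ} (hk₁0 : 0 ≤ k₁) (hk₁ : k₁ < Real.pi / 2) :
    ∃ c : ℝ, 0 < c ∧ (∀ k₀, |k₀| ≤ k₁ → c ≤ acc a k₀) ∧ ∀ k₀, |k₀| ≤ k₁ →
      ∀ k ∈ Set.Icc (-(Real.pi / 2)) (Real.pi / 2), c * |k - k₀| ≤ |vel a k - vel a k₀| := by
  have hpi := Real.pi_pos
  have ha2 : 0 < 1 - a ^ 2 := by nlinarith
  have hC : 0 < a * (1 - a ^ 2) := by positivity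
  have hmain : ∀ k ∈ Set.Icc (-(Real.pi / 2)) (Real.pi / 2), a * (1 - a ^ 2) * Real.cos k ≤ acc a k := by
    intro k hk
    have hS := sinE_pos ha ha1 k
    rw [acc, le_div_iff₀ (by positivity)]
    have : sinE a k ^ 3 ≤ 1 := pow_le_one₀ hS.le (sinE_le_one k)
    have := Real.cos_nonneg_of_mem_Icc hk
    exact mul_le_of_le_one_right (by positivity) ‹_›
  have hmono : MonotoneOn (fun k => vel a k - a * (1 - a ^ 2) * Real.sin k)
      (Set.Icc (-(Real.pi / 2)) (Real.pi / 2)) := by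
    have hd : ∀ k, HasDerivAt (fun k => vel a k - a * (1 - a ^ 2) * Real.sin k)
        (acc a k - a * (1 - a ^ 2) * Real.cos k) k := fun k =>
      (hasDerivAt_vel ha ha1 k).fun_sub ((Real.hasDerivAt_sin k).const_mul _)
    apply monotoneOn_of_deriv_nonneg (convex_Icc _ _)
    · exact fun k _ => (hd k).continuousAt.continuousWithinAt
    · exact fun k _ => (hd k).differentiableAt.differentiableWithinAt
    · intro k hk
      rw [(hd k).deriv]
      linarith [hmain k (interior_subset hk)]
  have hc1 : 0 < Real.cos ((Real.pi / 2 + k₁) / 2) :=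
    Real.cos_pos_of_mem_Ioo ⟨by linarith, by linarith⟩
  have hc2 : 0 < Real.cos k₁ := Real.cos_pos_of_mem_Ioo ⟨by linarith, by linarith⟩
  have hlow : ∀ k₀ k, k₀ ∈ Set.Icc (-(Real.pi / 2)) (Real.pi / 2) →
      k ∈ Set.Icc (-(Real.pi / 2)) (Real.pi / 2) → k₀ ≤ k → (|k₀| ≤ k₁ ∨ |k| ≤ k₁) →
      a * (1 - a ^ 2) * (2 / Real.pi * Real.cos ((Real.pi / 2 + k₁) / 2)) * (k - k₀)
        ≤ vel a k - vel a k₀ := by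
    intro k₀ k h0 hk hle hor
    have hm := hmono h0 hk hle
    simp only at hm
    have hsin : 2 / Real.pi * Real.cos ((Real.pi / 2 + k₁) / 2) * (k - k₀)
        ≤ Real.sin k - Real.sin k₀ := by
      rcases hor with h | h
      · exact sin_sub_sin_lower hk₁ h (abs_le.mpr ⟨hk.1, hk.2⟩) hle
      -- When the upper point is the restricted one, reflection at 0 exchanges the roles.
      · have := sin_sub_sin_lower (k₀ := -k) (k := -k₀) hk₁ (by rwa [abs_neg])
          (by rw [abs_neg]; exact abs_le.mpr ⟨h0.1, h0.2⟩) (by linarith)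
        rw [Real.sin_neg, Real.sin_neg] at this
        calc _ = 2 / Real.pi * Real.cos ((Real.pi / 2 + k₁) / 2) * (-k₀ - -k) := by ring
          _ ≤ _ := this
          _ = _ := by ring
    have := mul_le_mul_of_nonneg_left hsin hC.le
    rw [← mul_assoc] at this
    linarith
  refine ⟨min (a * (1 - a ^ 2) * (2 / Real.pi * Real.cos ((Real.pi / 2 + k₁) / 2)))
    (a * (1 - a ^ 2) * Real.cos k₁), by positivity, ?_, ?_⟩
  · intro k₀ h0
    have a0 := abs_le.mp h0
    refine (min_le_right _ _).trans (le_trans ?_ (hmain k₀ ⟨by linarith, by linarith⟩))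
    apply mul_le_mul_of_nonneg_left _ hC.le
    rw [← Real.cos_abs k₀]
    exact Real.cos_le_cos_of_nonneg_of_le_pi (abs_nonneg _) (by linarith) h0
  · intro k₀ h0 k hk
    have a0 := abs_le.mp h0
    have h0' : k₀ ∈ Set.Icc (-(Real.pi / 2)) (Real.pi / 2) := ⟨by linarith, by linarith⟩
    refine (mul_le_mul_of_nonneg_right (min_le_left _ _) (abs_nonneg _)).trans ?_
    rcases le_total k₀ k with hle | hle
    · rw [abs_of_nonneg (by linarith : 0 ≤ k - k₀)]
      exact (hlow k₀ k h0' hk hle (Or.inl h0)).trans (le_abs_self _)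
    · rw [abs_sub_comm k, abs_sub_comm (vel a k), abs_of_nonneg (by linarith : 0 ≤ k₀ - k)]
      exact (hlow k k₀ hk h0' hle (Or.inr h0)).trans (le_abs_self _)

end dispersion

/-! ### Fourier representation of the walk with a real coin -/

/-- Upper component of the eigenvector amplitude; `σ = ± i` distinguishes the two stationary
points. -/
def ampL (a b : ℝ) (u w σ : ℂ) (k : ℝ) : ℂ :=
  (1 - vel a k) * u - σ * b * Complex.exp (-(σ * k)) / sinE a k * w

/-- Lower component of the eigenvector amplitude. -/
def ampR (a b : ℝ) (u w σ : ℂ) (k : ℝ) : ℂ :=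
  σ * b * Complex.exp (σ * k) / sinE a k * u + (1 + vel a k) * w

/-- The oscillatory integral over both branches with amplitude `A`. -/
def oscInt (a : ℝ) (A : ℂ → ℝ → ℂ) (n : ℕ) (x : ℤ) : ℂ :=
  1 / (2 * Real.pi) * ∫ k in (-(Real.pi / 2))..(Real.pi / 2),
    (Complex.exp (Complex.I * (n * energy a k - x * k)) * A Complex.I k
      + Complex.exp (-Complex.I * (n * energy a k - x * k)) * A (-Complex.I) k)

section walk

variable {a b : ℝ}

lemma exp_mul_ofReal_of_sq {σ : ℂ} (hσ : σ = Complex.I ∨ σ = -Complex.I) (k : ℝ) :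
    Complex.exp (σ * k) = Real.cos k + σ * Real.sin k := by
  rcases hσ with rfl | rfl
  · rw [mul_comm, Complex.exp_mul_I]; push_cast; ring
  · rw [neg_mul, ← mul_neg, mul_comm, Complex.exp_mul_I, Complex.cos_neg, Complex.sin_neg]
    push_cast; ring

lemma exp_mul_energy (ha : 0 < a) (ha1 : a < 1) {σ : ℂ} (hσ : σ = Complex.I ∨ σ = -Complex.I)
    (k : ℝ) : Complex.exp (σ * energy a k) = a * Real.cos k + σ * sinE a k := by
  have h1 := abs_lt.mp ((sq_lt_one_iff_abs_lt_one _).mp (sq_mul_cos_lt_one ha ha1 k))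
  rw [exp_mul_ofReal_of_sq hσ, energy, Real.cos_arccos h1.1.le h1.2.le, Real.sin_arccos, sinE]
  push_cast; ring

lemma sq_of_eq_I_or {σ : ℂ} (hσ : σ = Complex.I ∨ σ = -Complex.I) : σ ^ 2 = -1 := by
  rcases hσ with rfl | rfl <;> simp

/-- The vector `(ampL, ampR)` is twice the spectral projection of `(u, w)` onto the eigenvalue
`exp(σ ω(k))` of the Fourier symbol `diag(exp(-σk), exp(σk)) (a, b; -b, a)`, which has determinant 1
and trace `2 a cos k`. The value `σ = -i` describes wave number `-k` and energy `-ω`. -/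
lemma amp_eigen (ha : 0 < a) (ha1 : a < 1) (hab : a ^ 2 + b ^ 2 = 1) (u w : ℂ) {σ : ℂ}
    (hσ : σ = Complex.I ∨ σ = -Complex.I) (k : ℝ) :
    Complex.exp (-(σ * k)) * (a * ampL a b u w σ k + b * ampR a b u w σ k)
      = Complex.exp (σ * energy a k) * ampL a b u w σ k ∧
    Complex.exp (σ * k) * (-b * ampL a b u w σ k + a * ampR a b u w σ k)
      = Complex.exp (σ * energy a k) * ampR a b u w σ k := by
  have hS : (sinE a k : ℂ) ≠ 0 := by exact_mod_cast (sinE_pos ha ha1 k).ne'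
  have H1 := sq_of_eq_I_or hσ
  have H2 : ((Real.cos k : ℝ) : ℂ) ^ 2 + ((Real.sin k : ℝ) : ℂ) ^ 2 = 1 := by
    exact_mod_cast Real.cos_sq_add_sin_sq k
  have H3 : (sinE a k : ℂ) ^ 2 = b ^ 2 + a ^ 2 * (Real.sin k : ℝ) ^ 2 := by
    have : sinE a k ^ 2 = b ^ 2 + a ^ 2 * Real.sin k ^ 2 := by rw [sinE_sq ha ha1]; linarith
    exact_mod_cast this
  have hneg : Complex.exp (-(σ * k)) = Real.cos k - σ * Real.sin k := by
    have := exp_mul_ofReal_of_sq hσ (-k)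
    rw [Real.cos_neg, Real.sin_neg] at this
    push_cast at this
    rw [← mul_neg, this]; push_cast; ring
  have hv : (vel a k : ℂ) = a * (Real.sin k : ℝ) / sinE a k := by rw [vel]; push_cast; ring
  unfold ampL ampR
  rw [hneg, exp_mul_energy ha ha1 hσ, exp_mul_ofReal_of_sq hσ, hv]
  generalize (sinE a k : ℂ) = S at *
  generalize ((Real.cos k : ℝ) : ℂ) = c at *
  generalize ((Real.sin k : ℝ) : ℂ) = s at *
  generalize (a : ℂ) = a at *
  generalize (b : ℂ) = b at *
  constructor
  · field_simp
    linear_combination (σ * b ^ 2 * u) * H2 - (σ * b ^ 2 * s ^ 2 * u) * H1 - σ * u * H3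
      + b * (c - σ * s) * (a * s + S) * w * H1
  · field_simp
    linear_combination (σ * b ^ 2 * w) * H2 - (σ * b ^ 2 * s ^ 2 * w) * H1 - σ * w * H3
      + b * (c + σ * s) * (a * s - S) * u * H1

lemma continuous_ampL (ha : 0 < a) (ha1 : a < 1) (u w σ : ℂ) : Continuous (ampL a b u w σ) := by
  have h1 := continuous_sinE (a := a)
  have h2 := continuous_vel ha ha1
  have : Continuous fun k : ℝ => σ * b * Complex.exp (-(σ * k)) / (sinE a k : ℂ) :=
    Continuous.div (by fun_prop) (by fun_prop)
      fun k => by exact_mod_cast (sinE_pos ha ha1 k).ne'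
  unfold ampL
  fun_prop

lemma continuous_ampR (ha : 0 < a) (ha1 : a < 1) (u w σ : ℂ) : Continuous (ampR a b u w σ) := by
  have h1 := continuous_sinE (a := a)
  have h2 := continuous_vel ha ha1
  have : Continuous fun k : ℝ => σ * b * Complex.exp (σ * k) / (sinE a k : ℂ) :=
    Continuous.div (by fun_prop) (by fun_prop)
      fun k => by exact_mod_cast (sinE_pos ha ha1 k).ne'
  unfold ampR
  fun_prop

lemma continuous_oscInt_integrand {A : ℂ → ℝ → ℂ} (hA : ∀ σ, Continuous (A σ)) (n : ℕ) (x : ℤ) :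
    Continuous fun k : ℝ => Complex.exp (Complex.I * (n * energy a k - x * k)) * A Complex.I k
      + Complex.exp (-Complex.I * (n * energy a k - x * k)) * A (-Complex.I) k := by
  have h1 := continuous_energy (a := a)
  have h2 := hA Complex.I
  have h3 := hA (-Complex.I)
  fun_prop

/-- Shifting `x` by one contributes `exp(-σk)` to the integrand; the eigenvector equation turns this
into `exp(σω)`, that is, into one more time step. -/
lemma oscInt_ampL_succ (ha : 0 < a) (ha1 : a < 1) (hab : a ^ 2 + b ^ 2 = 1) (u w : ℂ) (n : ℕ)
    (x : ℤ) : oscInt a (ampL a b u w) (n + 1) x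
      = a * oscInt a (ampL a b u w) n (x + 1) + b * oscInt a (ampR a b u w) n (x + 1) := by
  have hL : ∀ σ, Continuous (ampL a b u w σ) := continuous_ampL ha ha1 u w
  have hR : ∀ σ, Continuous (ampR a b u w σ) := continuous_ampR ha ha1 u w
  unfold oscInt
  rw [mul_left_comm (a : ℂ), mul_left_comm (b : ℂ), ← mul_add,
    ← intervalIntegral.integral_const_mul (a : ℂ), ← intervalIntegral.integral_const_mul (b : ℂ),
    ← intervalIntegral.integral_add
      (((continuous_oscInt_integrand hL _ _).const_mul _).intervalIntegrable _ _)
      (((continuous_oscInt_integrand hR _ _).const_mul _).intervalIntegrable _ _)]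
  congr 1
  apply intervalIntegral.integral_congr
  intro k _
  have key : ∀ σ : ℂ, σ = Complex.I ∨ σ = -Complex.I →
      Complex.exp (σ * ((n + 1 : ℕ) * energy a k - x * k)) * ampL a b u w σ k
      = Complex.exp (σ * (n * energy a k - (x + 1 : ℤ) * k))
        * (a * ampL a b u w σ k + b * ampR a b u w σ k) := by
    intro σ hσ
    have e1 : Complex.exp (σ * ((n + 1 : ℕ) * energy a k - x * k))
        = Complex.exp (σ * (n * energy a k - x * k)) * Complex.exp (σ * energy a k) := by
      rw [← Complex.exp_add]; push_cast; ring_nf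
    have e2 : Complex.exp (σ * (n * energy a k - (x + 1 : ℤ) * k))
        = Complex.exp (σ * (n * energy a k - x * k)) * Complex.exp (-(σ * k)) := by
      rw [← Complex.exp_add]; push_cast; ring_nf
    rw [e1, e2, mul_assoc, mul_assoc, (amp_eigen ha ha1 hab u w hσ k).1]
  simp only
  rw [key _ (Or.inl rfl), key _ (Or.inr rfl)]
  ring

lemma oscInt_ampR_succ (ha : 0 < a) (ha1 : a < 1) (hab : a ^ 2 + b ^ 2 = 1) (u w : ℂ) (n : ℕ)
    (x : ℤ) : oscInt a (ampR a b u w) (n + 1) x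
      = -b * oscInt a (ampL a b u w) n (x - 1) + a * oscInt a (ampR a b u w) n (x - 1) := by
  have hL : ∀ σ, Continuous (ampL a b u w σ) := continuous_ampL ha ha1 u w
  have hR : ∀ σ, Continuous (ampR a b u w σ) := continuous_ampR ha ha1 u w
  unfold oscInt
  rw [mul_left_comm (a : ℂ), mul_left_comm (-b : ℂ), ← mul_add,
    ← intervalIntegral.integral_const_mul (-b : ℂ), ← intervalIntegral.integral_const_mul (a : ℂ),
    ← intervalIntegral.integral_add
      (((continuous_oscInt_integrand hL _ _).const_mul _).intervalIntegrable _ _)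
      (((continuous_oscInt_integrand hR _ _).const_mul _).intervalIntegrable _ _)]
  congr 1
  apply intervalIntegral.integral_congr
  intro k _
  have key : ∀ σ : ℂ, σ = Complex.I ∨ σ = -Complex.I →
      Complex.exp (σ * ((n + 1 : ℕ) * energy a k - x * k)) * ampR a b u w σ k
      = Complex.exp (σ * (n * energy a k - (x - 1 : ℤ) * k))
        * (-b * ampL a b u w σ k + a * ampR a b u w σ k) := by
    intro σ hσ
    have e1 : Complex.exp (σ * ((n + 1 : ℕ) * energy a k - x * k))
        = Complex.exp (σ * (n * energy a k - x * k)) * Complex.exp (σ * energy a k) := by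
      rw [← Complex.exp_add]; push_cast; ring_nf
    have e2 : Complex.exp (σ * (n * energy a k - (x - 1 : ℤ) * k))
        = Complex.exp (σ * (n * energy a k - x * k)) * Complex.exp (σ * k) := by
      rw [← Complex.exp_add]; push_cast; ring_nf
    rw [e1, e2, mul_assoc, mul_assoc, (amp_eigen ha ha1 hab u w hσ k).2]
  simp only
  rw [key _ (Or.inl rfl), key _ (Or.inr rfl)]
  ring

/-- For even `x` the exponential has period `π`, so half of the Brillouin zone already gives
orthogonality. This is why the integrals run over `[-π/2, π/2]` and why parity is assumed
throughout. -/
lemma integral_exp_even {x : ℤ} (hx : Even x) :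
    ∫ k in (-(Real.pi / 2))..(Real.pi / 2), Complex.exp (-(Complex.I * x) * (k : ℂ))
      = if x = 0 then (Real.pi : ℂ) else 0 := by
  split_ifs with h
  · subst h
    simp only [Int.cast_zero, mul_zero, neg_zero, zero_mul, Complex.exp_zero,
      intervalIntegral.integral_const, sub_neg_eq_add, add_halves]
    simp
  · have hc : -(Complex.I * x) ≠ 0 := by simp [h]
    obtain ⟨m, rfl⟩ := hx
    rw [integral_exp_mul_complex hc]
    have : Complex.exp (-(Complex.I * ((m + m : ℤ) : ℂ)) * ((Real.pi / 2 : ℝ) : ℂ))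
        = Complex.exp (-(Complex.I * ((m + m : ℤ) : ℂ)) * ((-(Real.pi / 2) : ℝ) : ℂ)) := by
      rw [Complex.exp_eq_exp_iff_exists_int]
      exact ⟨-m, by push_cast; ring⟩
    rw [this, sub_self, zero_div]

/-- Reflecting `k` in the second branch gives both branches the same exponential at time 0. The
hypothesis `hz` then says that the two spectral projections add up to the identity, doubled by the
normalization. -/
lemma oscInt_zero_of_symm {A : ℂ → ℝ → ℂ} (hA : ∀ σ, Continuous (A σ)) {z : ℂ}
    (hz : ∀ k, A Complex.I k + A (-Complex.I) (-k) = 2 * z) {x : ℤ} (hx : Even x) :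
    oscInt a A 0 x = if x = 0 then z else 0 := by
  have hpi : (Real.pi : ℂ) ≠ 0 := by exact_mod_cast Real.pi_ne_zero
  have h2 := hA Complex.I
  have h3 := hA (-Complex.I)
  unfold oscInt
  have h1 : ∫ k in (-(Real.pi / 2))..(Real.pi / 2),
      Complex.exp (-Complex.I * ((0 : ℕ) * energy a k - x * k)) * A (-Complex.I) k
      = ∫ k in (-(Real.pi / 2))..(Real.pi / 2),
        Complex.exp (-(Complex.I * x) * (k : ℂ)) * A (-Complex.I) (-k) := by
    have := intervalIntegral.integral_comp_neg (a := -(Real.pi / 2)) (b := Real.pi / 2)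
      (fun k : ℝ => Complex.exp (-Complex.I * ((0 : ℕ) * energy a k - x * k)) * A (-Complex.I) k)
    rw [neg_neg] at this
    rw [← this]
    apply intervalIntegral.integral_congr
    intro k _
    simp only
    congr 2; push_cast; ring
  have h4 := continuous_energy (a := a)
  rw [intervalIntegral.integral_add
    ((by fun_prop : Continuous fun k : ℝ =>
      Complex.exp (Complex.I * ((0 : ℕ) * energy a k - x * k)) * A Complex.I k).intervalIntegrable _ _)
    ((by fun_prop : Continuous fun k : ℝ =>
      Complex.exp (-Complex.I * ((0 : ℕ) * energy a k - x * k)) * A (-Complex.I) k).intervalIntegrable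
        _ _), h1,
    ← intervalIntegral.integral_add
    ((by fun_prop : Continuous fun k : ℝ =>
      Complex.exp (Complex.I * ((0 : ℕ) * energy a k - x * k)) * A Complex.I k).intervalIntegrable _ _)
    ((by fun_prop : Continuous fun k : ℝ =>
      Complex.exp (-(Complex.I * x) * (k : ℂ)) * A (-Complex.I) (-k)).intervalIntegrable _ _)]
  have h5 : ∫ k in (-(Real.pi / 2))..(Real.pi / 2),
      (Complex.exp (Complex.I * ((0 : ℕ) * energy a k - x * k)) * A Complex.I k
      + Complex.exp (-(Complex.I * x) * (k : ℂ)) * A (-Complex.I) (-k))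
      = ∫ k in (-(Real.pi / 2))..(Real.pi / 2), Complex.exp (-(Complex.I * x) * (k : ℂ)) * (2 * z) := by
    apply intervalIntegral.integral_congr
    intro k _
    simp only
    rw [← hz k, mul_add]
    congr 3; push_cast; ring
  rw [h5, intervalIntegral.integral_mul_const, integral_exp_even hx]
  split_ifs
  · field_simp
  · simp

lemma vel_neg (k : ℝ) : vel a (-k) = -vel a k := by
  simp [vel, sinE, neg_div]

lemma sinE_neg (k : ℝ) : sinE a (-k) = sinE a k := by
  simp [sinE]

lemma oscInt_ampL_zero (ha : 0 < a) (ha1 : a < 1) (u w : ℂ) {x : ℤ} (hx : Even x) :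
    oscInt a (ampL a b u w) 0 x = if x = 0 then u else 0 :=
  oscInt_zero_of_symm (continuous_ampL ha ha1 u w) (fun k => by
    unfold ampL; rw [vel_neg, sinE_neg]; push_cast; ring_nf) hx

lemma oscInt_ampR_zero (ha : 0 < a) (ha1 : a < 1) (u w : ℂ) {x : ℤ} (hx : Even x) :
    oscInt a (ampR a b u w) 0 x = if x = 0 then w else 0 :=
  oscInt_zero_of_symm (continuous_ampR ha ha1 u w) (fun k => by
    unfold ampR; rw [vel_neg, sinE_neg]; push_cast; ring_nf) hx

end walk

/-! ### Reduction of a unitary coin to the real coin -/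

section coin

variable {C : Matrix (Fin 2) (Fin 2) ℂ} {φ : EuclideanSpace ℂ (Fin 2)}

lemma act_P_apply_zero (v : EuclideanSpace ℂ (Fin 2)) :
    (act (P C) v).ofLp 0 = C 0 0 * v.ofLp 0 + C 0 1 * v.ofLp 1 := by
  simp [act, P, dotProduct, Fin.sum_univ_two]

lemma act_P_apply_one (v : EuclideanSpace ℂ (Fin 2)) : (act (P C) v).ofLp 1 = 0 := by
  simp [act, P, dotProduct, Fin.sum_univ_two]

lemma act_Q_apply_zero (v : EuclideanSpace ℂ (Fin 2)) : (act (Q C) v).ofLp 0 = 0 := by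
  simp [act, Q, dotProduct, Fin.sum_univ_two]

lemma act_Q_apply_one (v : EuclideanSpace ℂ (Fin 2)) :
    (act (Q C) v).ofLp 1 = C 1 0 * v.ofLp 0 + C 1 1 * v.ofLp 1 := by
  simp [act, Q, dotProduct, Fin.sum_univ_two]

lemma Psi_succ_zero (n : ℕ) (x : ℤ) : (Psi C φ (n + 1) x).ofLp 0
    = C 0 0 * (Psi C φ n (x + 1)).ofLp 0 + C 0 1 * (Psi C φ n (x + 1)).ofLp 1 := by
  rw [Psi, PiLp.add_apply, act_P_apply_zero, act_Q_apply_zero, add_zero]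

lemma Psi_succ_one (n : ℕ) (x : ℤ) : (Psi C φ (n + 1) x).ofLp 1
    = C 1 0 * (Psi C φ n (x - 1)).ofLp 0 + C 1 1 * (Psi C φ n (x - 1)).ofLp 1 := by
  rw [Psi, PiLp.add_apply, act_P_apply_one, act_Q_apply_one, zero_add]

/-- The numerators of `p_n` and `q_n` are single components one time step later, hence covered by
the same integral representation. -/
lemma norm_sq_act_P_Psi (n : ℕ) (x : ℤ) :
    ‖act (P C) (Psi C φ n x)‖ ^ 2 = ‖(Psi C φ (n + 1) (x - 1)).ofLp 0‖ ^ 2 := by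
  rw [EuclideanSpace.norm_sq_eq, Fin.sum_univ_two, act_P_apply_one, act_P_apply_zero, Psi_succ_zero,
    sub_add_cancel]
  simp

lemma norm_sq_act_Q_Psi (n : ℕ) (x : ℤ) :
    ‖act (Q C) (Psi C φ n x)‖ ^ 2 = ‖(Psi C φ (n + 1) (x + 1)).ofLp 1‖ ^ 2 := by
  rw [EuclideanSpace.norm_sq_eq, Fin.sum_univ_two, act_Q_apply_one, act_Q_apply_zero, Psi_succ_one,
    add_sub_cancel_right]
  simp

lemma even_of_Psi_ne_zero : ∀ (n : ℕ) (x : ℤ), Psi C φ n x ≠ 0 → Even ((n : ℤ) + x)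
  | 0, x, h => by
    rw [Psi] at h
    split_ifs at h with hx
    · simp [hx]
    · exact absurd rfl h
  | n + 1, x, h => by
    have act_zero : ∀ M, act M 0 = 0 := fun M => by simp [act]
    rw [Psi] at h
    by_cases h1 : Psi C φ n (x + 1) = 0
    · by_cases h2 : Psi C φ n (x - 1) = 0
      · rw [h1, h2, act_zero, act_zero, add_zero] at h
        exact absurd rfl h
      · have := even_of_Psi_ne_zero n (x - 1) h2
        rw [show ((n + 1 : ℕ) : ℤ) + x = (n : ℤ) + (x - 1) + 2 by push_cast; ring]
        exact this.add even_two
    · have := even_of_Psi_ne_zero n (x + 1) h1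
      rw [show ((n + 1 : ℕ) : ℤ) + x = (n : ℤ) + (x + 1) by push_cast; ring]
      exact this

/-- Normal form of the lower row of a unitary matrix. -/
lemma unitary_lower_row (hC : C ∈ Matrix.unitaryGroup (Fin 2) ℂ) :
    C 1 1 = C.det * star (C 0 0) ∧ C 1 0 = -(C.det * star (C 0 1)) ∧ ‖C.det‖ = 1 := by
  have h1 : star C * C = 1 := (Matrix.mem_unitaryGroup_iff').mp hC
  have h2 : C.adjugate = C.det • star C := by
    have : star C * (C * C.adjugate) = C.adjugate := by rw [← mul_assoc, h1, one_mul]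
    rw [← this, Matrix.mul_adjugate, Matrix.mul_smul, mul_one]
  have e00 := congrFun (congrFun h2 0) 0
  have e10 := congrFun (congrFun h2 1) 0
  rw [Matrix.adjugate_fin_two] at e00 e10
  simp [Matrix.star_apply] at e00 e10
  refine ⟨e00, neg_eq_iff_eq_neg.mp e10, ?_⟩
  have := Matrix.det_of_mem_unitary hC
  exact CStarRing.norm_of_mem_unitary this

lemma unitary_row_norm (hC : C ∈ Matrix.unitaryGroup (Fin 2) ℂ) :
    ‖C 0 0‖ ^ 2 + ‖C 0 1‖ ^ 2 = 1 := by
  have h1 : C * star C = 1 := (Matrix.mem_unitaryGroup_iff).mp hC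
  have e := congrFun (congrFun h1 0) 0
  simp only [Matrix.mul_apply, Fin.sum_univ_two, Matrix.star_apply, Matrix.one_apply_eq] at e
  rw [RCLike.star_def, Complex.mul_conj', Complex.mul_conj'] at e
  exact_mod_cast e

/-- `P` and `Q` map into orthogonal coordinate axes and add up to the isometry `C`. -/
lemma norm_sq_eq_act_add (hC : C ∈ Matrix.unitaryGroup (Fin 2) ℂ) (v : EuclideanSpace ℂ (Fin 2)) :
    ‖v‖ ^ 2 = ‖act (P C) v‖ ^ 2 + ‖act (Q C) v‖ ^ 2 := by
  obtain ⟨h11, h10, hd⟩ := unitary_lower_row hC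
  have hr := unitary_row_norm hC
  simp only [EuclideanSpace.norm_sq_eq, Fin.sum_univ_two, act_P_apply_zero, act_P_apply_one,
    act_Q_apply_zero, act_Q_apply_one, norm_zero]
  have e : C 1 0 * v.ofLp 0 + C 1 1 * v.ofLp 1
      = C.det * (-(star (C 0 1)) * v.ofLp 0 + star (C 0 0) * v.ofLp 1) := by
    rw [h11, h10]; ring
  rw [e, norm_mul, hd, one_mul]
  simp only [← Complex.normSq_eq_norm_sq, Complex.normSq_apply] at hr ⊢
  simp only [Complex.add_re, Complex.add_im, Complex.mul_re, Complex.mul_im, Complex.neg_re,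
    Complex.neg_im, RCLike.star_def, Complex.conj_re, Complex.conj_im]
  linear_combination (-(v.ofLp 0).re ^ 2 - (v.ofLp 0).im ^ 2 - (v.ofLp 1).re ^ 2 - (v.ofLp 1).im ^ 2) * hr

/-- Up to phases the walk is given by the oscillatory integrals of the real coin. -/
lemma exists_norm_Psi_eq_oscInt (hC : C ∈ Matrix.unitaryGroup (Fin 2) ℂ) (ha : C 0 0 ≠ 0)
    (hb : C 0 1 ≠ 0) (hφ : ‖φ‖ = 1) :
    ∃ u w : ℂ, ‖u‖ ^ 2 + ‖w‖ ^ 2 = 1 ∧ ∀ (n : ℕ) (x : ℤ), Even ((n : ℤ) + x) →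
      ‖(Psi C φ n x).ofLp 0‖ = ‖oscInt ‖C 0 0‖ (ampL ‖C 0 0‖ ‖C 0 1‖ u w) n x‖ ∧
      ‖(Psi C φ n x).ofLp 1‖ = ‖oscInt ‖C 0 0‖ (ampR ‖C 0 0‖ ‖C 0 1‖ u w) n x‖ := by
  obtain ⟨h11, h10, hd⟩ := unitary_lower_row hC
  have hr := unitary_row_norm hC
  set a := ‖C 0 0‖ with hadef
  set b := ‖C 0 1‖ with hbdef
  have ha0 : 0 < a := norm_pos_iff.mpr ha
  have hb0 : 0 < b := norm_pos_iff.mpr hb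
  have ha1 : a < 1 := by nlinarith
  have hac : (a : ℂ) ≠ 0 := by exact_mod_cast ha0.ne'
  have hbc : (b : ℂ) ≠ 0 := by exact_mod_cast hb0.ne'
  -- The phases to be removed: `e` is a square root of the determinant, `U` is the phase of `C 0 0`,
  -- and `U T` that of `C 0 1`.
  obtain ⟨e, he⟩ := IsAlgClosed.exists_pow_nat_eq C.det (n := 2) (by norm_num)
  have hen : ‖e‖ = 1 := by
    have : ‖e‖ ^ 2 = 1 := by rw [← norm_pow, he, hd]
    exact (pow_eq_one_iff_of_nonneg (norm_nonneg e) two_ne_zero).mp this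
  have he0 : e ≠ 0 := norm_ne_zero_iff.mp (by rw [hen]; norm_num)
  set U := C 0 0 / a with hU
  have hUn : ‖U‖ = 1 := by rw [hU, norm_div, Complex.norm_real, Real.norm_of_nonneg ha0.le, ← hadef,
    div_self ha0.ne']
  have hU0 : U ≠ 0 := norm_ne_zero_iff.mp (by rw [hUn]; norm_num)
  set T := C 0 1 / (U * b) with hT
  have hTn : ‖T‖ = 1 := by
    rw [hT, norm_div, norm_mul, hUn, one_mul, Complex.norm_real, Real.norm_of_nonneg hb0.le, ← hbdef,
      div_self hb0.ne']
  have hT0 : T ≠ 0 := norm_ne_zero_iff.mp (by rw [hTn]; norm_num)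
  have star_inv : ∀ z : ℂ, ‖z‖ = 1 → star z = z⁻¹ := fun z hz => by
    rw [RCLike.star_def, Complex.inv_def, Complex.normSq_eq_norm_sq, hz]; simp
  have c00 : C 0 0 = U * a := by rw [hU]; field_simp
  have c01 : C 0 1 = U * T * b := by rw [hT]; field_simp
  have c10 : C 1 0 = -(e ^ 2 * (U⁻¹ * T⁻¹ * b)) := by
    rw [h10, ← he, c01, star_mul', star_mul', star_inv U hUn, star_inv T hTn]
    simp
  have c11 : C 1 1 = e ^ 2 * (U⁻¹ * a) := by
    rw [h11, ← he, c00, star_mul', star_inv U hUn]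
    simp
  refine ⟨φ.ofLp 0, T * φ.ofLp 1, ?_, ?_⟩
  · rw [norm_mul, hTn, one_mul]
    have := EuclideanSpace.norm_sq_eq φ
    rw [Fin.sum_univ_two, hφ] at this
    linarith
  set u := φ.ofLp 0
  set w := T * φ.ofLp 1 with hw
  -- The gauge factor is `e^n (e/U)^x`, with an additional `T⁻¹` on the lower component; this is
  -- compensated at time 0 by the factor `T` in `w`. All these factors have modulus 1.
  have key : ∀ (n : ℕ) (x : ℤ), Even ((n : ℤ) + x) →
      (Psi C φ n x).ofLp 0 = e ^ n * (e / U) ^ x * oscInt a (ampL a b u w) n x ∧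
      (Psi C φ n x).ofLp 1 = e ^ n * (e / U) ^ x * (T⁻¹ * oscInt a (ampR a b u w) n x) := by
    intro n
    induction n with
    | zero =>
      intro x hx
      have hx' : Even x := by simpa using hx
      rw [oscInt_ampL_zero ha0 ha1 u w hx', oscInt_ampR_zero ha0 ha1 u w hx', Psi]
      split_ifs with h
      · subst h
        simp [u, hw, hT0]
      · simp
    | succ n ih =>
      intro x hx
      have hxp : Even ((n : ℤ) + (x + 1)) := by
        rw [show (n : ℤ) + (x + 1) = ((n + 1 : ℕ) : ℤ) + x by push_cast; ring]; exact hx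
      have hxm : Even ((n : ℤ) + (x - 1)) := by
        rw [show (n : ℤ) + (x - 1) = (n : ℤ) + (x + 1) - 2 by ring]; exact hxp.sub even_two
      have hq : e / U ≠ 0 := div_ne_zero he0 hU0
      rw [Psi_succ_zero, Psi_succ_one, (ih _ hxp).1, (ih _ hxp).2, (ih _ hxm).1, (ih _ hxm).2,
        oscInt_ampL_succ ha0 ha1 hr, oscInt_ampR_succ ha0 ha1 hr, c00, c01, c10, c11,
        zpow_add_one₀ hq, zpow_sub_one₀ hq]
      constructor
      · field_simp
        ring
      · field_simp
        ring
  intro n x hx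
  have hqn : ‖e / U‖ = 1 := by rw [norm_div, hen, hUn, div_one]
  obtain ⟨k0, k1⟩ := key n x hx
  constructor
  · rw [k0, norm_mul, norm_mul, norm_pow, norm_zpow, hqn, hen]; simp
  · rw [k1, norm_mul, norm_mul, norm_mul, norm_inv, norm_pow, norm_zpow, hqn, hen, hTn]; simp

end coin

/-! ### Leading term and interference of the two branches -/

/-- The square root of `i` occurring in the Fresnel integral. -/
def sqrtI : ℂ := Complex.I ^ (1 / 2 : ℂ)

lemma sqrtI_sq : sqrtI ^ 2 = Complex.I := by
  rw [sqrtI, ← Complex.cpow_nat_mul]; simp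

lemma norm_sqrtI : ‖sqrtI‖ = 1 := by
  have : ‖sqrtI‖ ^ 2 = 1 := by rw [← norm_pow, sqrtI_sq, Complex.norm_I]
  exact (pow_eq_one_iff_of_nonneg (norm_nonneg _) two_ne_zero).mp this

/-- A positive real factor comes out of the complex power, and `√n` cancels the dependence on `n`.
-/
lemma sqrt_mul_fresnel {n l : ℝ} (hn : 0 < n) (hl : 0 < l) :
    (√n : ℂ) * (2 * Real.pi * Complex.I / (n * l : ℝ)) ^ (1 / 2 : ℂ)
      = (√(2 * Real.pi / l) : ℝ) * sqrtI := by
  have hpi := Real.pi_pos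
  have hr : 0 < 2 * Real.pi / (n * l) := by positivity
  have h1 : (2 * Real.pi * Complex.I / (n * l : ℝ) : ℂ)
      = ((2 * Real.pi / (n * l) : ℝ) : ℂ) * Complex.I := by push_cast; ring
  have h2 : (2 * Real.pi * Complex.I / (n * l : ℝ) : ℂ) ^ (1 / 2 : ℂ)
      = (√(2 * Real.pi / (n * l)) : ℝ) * sqrtI := by
    rw [h1, sqrtI, Complex.cpow_def_of_ne_zero (mul_ne_zero (by exact_mod_cast hr.ne') Complex.I_ne_zero),
      Complex.log_ofReal_mul hr Complex.I_ne_zero, add_mul, Complex.exp_add,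
      Complex.cpow_def_of_ne_zero Complex.I_ne_zero, Real.sqrt_eq_rpow, Real.rpow_def_of_pos hr]
    push_cast; rfl
  rw [h2, ← mul_assoc, ← Complex.ofReal_mul, ← Real.sqrt_mul hn.le]
  congr 3
  field_simp

/-- The total phase per step at the stationary point. -/
def phase (a s : ℝ) : ℝ := energy a (waveNumber a s) - s * waveNumber a s

/-- The leading term of the oscillatory integral, at velocity `s` and with phase `θ`. -/
def lead (a : ℝ) (A : ℂ → ℝ → ℂ) (s θ : ℝ) : ℂ :=
  1 / (2 * Real.pi) * ((√(2 * Real.pi / acc a (waveNumber a s)) : ℝ) *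
    (sqrtI * Complex.exp (Complex.I * θ) * A Complex.I (waveNumber a s)
      + star sqrtI * Complex.exp (-Complex.I * θ) * A (-Complex.I) (waveNumber a s)))

/-- The non-oscillating part of the squared modulus of the leading term. -/
def meanPart (a : ℝ) (A : ℂ → ℝ → ℂ) (s : ℝ) : ℝ :=
  (‖A Complex.I (waveNumber a s)‖ ^ 2 + ‖A (-Complex.I) (waveNumber a s)‖ ^ 2)
    / (2 * Real.pi * acc a (waveNumber a s))

/-- The coefficient of the oscillating part of the squared modulus of the leading term. -/
def crossPart (a : ℝ) (A : ℂ → ℝ → ℂ) (s : ℝ) : ℂ :=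
  2 * Complex.I * A Complex.I (waveNumber a s) * star (A (-Complex.I) (waveNumber a s))
    / (2 * Real.pi * acc a (waveNumber a s) : ℝ)

section asymptotics

variable {a : ℝ}

lemma norm_exp_neg_I_ofReal (x : ℝ) : ‖Complex.exp (-Complex.I * x)‖ = 1 := by
  have := norm_exp_I_ofReal (-x)
  rwa [Complex.ofReal_neg, mul_neg, ← neg_mul] at this

lemma star_exp_I (x : ℝ) : star (Complex.exp (Complex.I * x)) = Complex.exp (-Complex.I * x) := by
  rw [RCLike.star_def, ← Complex.exp_conj, map_mul, Complex.conj_I, Complex.conj_ofReal]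

/-- In the mixed product of the branches the conjugation doubles the phase to `2θ`, and the two
roots of `i` multiply to `i`. -/
lemma norm_lead_sq (ha : 0 < a) (ha1 : a < 1) {s : ℝ} (hs : |s| < a) (A : ℂ → ℝ → ℂ) (θ : ℝ) :
    ‖lead a A s θ‖ ^ 2
      = meanPart a A s + (crossPart a A s * Complex.exp (Complex.I * (2 * θ : ℝ))).re := by
  have hacc := acc_pos ha ha1 (waveNumber_mem ha ha1 hs)
  have hpi := Real.pi_pos
  unfold lead meanPart crossPart
  set κ := waveNumber a s
  set g := acc a κ
  have hconst : ‖(1 / (2 * Real.pi) : ℂ)‖ ^ 2 * (√(2 * Real.pi / g)) ^ 2 = 1 / (2 * Real.pi * g) := by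
    rw [Real.sq_sqrt (by positivity)]
    have : (1 / (2 * Real.pi) : ℂ) = ((1 / (2 * Real.pi) : ℝ) : ℂ) := by push_cast; rfl
    rw [this, Complex.norm_real, Real.norm_of_nonneg (by positivity)]
    field_simp
  rw [norm_mul, norm_mul, mul_pow, mul_pow, Complex.norm_real,
    Real.norm_of_nonneg (Real.sqrt_nonneg _), ← mul_assoc, hconst]
  have hsum : ∀ p q : ℂ, ‖p + q‖ ^ 2 = ‖p‖ ^ 2 + ‖q‖ ^ 2 + 2 * (p * star q).re := fun p q => by
    simp only [← Complex.normSq_eq_norm_sq, Complex.normSq_add, RCLike.star_def]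
  rw [hsum, norm_mul, norm_mul, norm_mul, norm_mul, norm_star, norm_sqrtI, norm_exp_I_ofReal,
    norm_exp_neg_I_ofReal]
  have e : sqrtI * Complex.exp (Complex.I * θ) * A Complex.I κ
      * star (star sqrtI * Complex.exp (-Complex.I * θ) * A (-Complex.I) κ)
      = Complex.I * A Complex.I κ * star (A (-Complex.I) κ) * Complex.exp (Complex.I * (2 * θ : ℝ)) := by
    rw [star_mul', star_mul', star_star, ← star_exp_I, star_star]
    have e2 : Complex.exp (Complex.I * (2 * θ : ℝ))
        = Complex.exp (Complex.I * θ) * Complex.exp (Complex.I * θ) := by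
      rw [← Complex.exp_add]; push_cast; ring_nf
    rw [e2, ← sqrtI_sq]; ring
  rw [e]
  have e3 : 2 * Complex.I * A Complex.I κ * star (A (-Complex.I) κ) / (2 * Real.pi * g : ℝ)
      * Complex.exp (Complex.I * (2 * θ : ℝ))
      = ((2 / (2 * Real.pi * g) : ℝ) : ℂ) * (Complex.I * A Complex.I κ * star (A (-Complex.I) κ)
        * Complex.exp (Complex.I * (2 * θ : ℝ))) := by
    push_cast; ring
  rw [e3, Complex.re_ofReal_mul]
  field_simp

/-- The arithmetic-geometric mean inequality. It bounds the leading term, and the oscillation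
relative to the mean density. -/
lemma norm_crossPart_le (ha : 0 < a) (ha1 : a < 1) {s : ℝ} (hs : |s| < a) (A : ℂ → ℝ → ℂ) :
    ‖crossPart a A s‖ ≤ meanPart a A s := by
  have hacc := acc_pos ha ha1 (waveNumber_mem ha ha1 hs)
  have hpi := Real.pi_pos
  have hd : 0 < 2 * Real.pi * acc a (waveNumber a s) := by positivity
  unfold crossPart meanPart
  rw [norm_div, Complex.norm_real, Real.norm_of_nonneg hd.le]
  apply div_le_div_of_nonneg_right _ hd.le
  rw [norm_mul, norm_mul, norm_mul, norm_star, Complex.norm_I]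
  have := two_mul_le_add_sq ‖A Complex.I (waveNumber a s)‖ ‖A (-Complex.I) (waveNumber a s)‖
  simpa using this

lemma re_mul_exp_le (z : ℂ) (θ : ℝ) : |(z * Complex.exp (Complex.I * θ)).re| ≤ ‖z‖ := by
  refine (Complex.abs_re_le_norm _).trans ?_
  rw [norm_mul, norm_exp_I_ofReal, mul_one]

lemma norm_lead_sq_le (ha : 0 < a) (ha1 : a < 1) {s : ℝ} (hs : |s| < a) (A : ℂ → ℝ → ℂ) (θ : ℝ) :
    ‖lead a A s θ‖ ^ 2 ≤ 2 * meanPart a A s := by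
  rw [norm_lead_sq ha ha1 hs]
  have := re_mul_exp_le (crossPart a A s) (2 * θ)
  have := norm_crossPart_le ha ha1 hs A
  linarith [le_abs_self (crossPart a A s * Complex.exp (Complex.I * (2 * θ : ℝ))).re]

lemma continuousOn_acc_waveNumber (ha : 0 < a) (ha1 : a < 1) :
    ContinuousOn (fun s => acc a (waveNumber a s)) (Set.Ioo (-a) a) :=
  (continuous_acc ha ha1).comp_continuousOn (continuousOn_waveNumber ha ha1)

lemma continuousOn_meanPart (ha : 0 < a) (ha1 : a < 1) {A : ℂ → ℝ → ℂ} (hA : ∀ σ, Continuous (A σ)) :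
    ContinuousOn (meanPart a A) (Set.Ioo (-a) a) := by
  have hκ := continuousOn_waveNumber ha ha1
  unfold meanPart
  apply ContinuousOn.div
  · exact (((hA _).comp_continuousOn hκ).norm.pow 2).add (((hA _).comp_continuousOn hκ).norm.pow 2)
  · exact continuousOn_const.mul (continuousOn_acc_waveNumber ha ha1)
  · intro s hs
    have := acc_pos ha ha1 (waveNumber_mem ha ha1 (abs_lt.mpr hs))
    have := Real.pi_pos
    positivity

lemma continuousOn_crossPart (ha : 0 < a) (ha1 : a < 1) {A : ℂ → ℝ → ℂ}
    (hA : ∀ σ, Continuous (A σ)) : ContinuousOn (crossPart a A) (Set.Ioo (-a) a) := by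
  have hκ := continuousOn_waveNumber ha ha1
  unfold crossPart
  apply ContinuousOn.div
  · exact (continuousOn_const.mul ((hA _).comp_continuousOn hκ)).mul
      (((hA _).comp_continuousOn hκ).star)
  · exact Complex.continuous_ofReal.comp_continuousOn
      (continuousOn_const.mul (continuousOn_acc_waveNumber ha ha1))
  · intro s hs
    have := acc_pos ha ha1 (waveNumber_mem ha ha1 (abs_lt.mpr hs))
    have := Real.pi_pos
    exact_mod_cast (by positivity : (2 * Real.pi * acc a (waveNumber a s)) ≠ 0)

/-- Compactness keeps the stationary points away from `±π/2`, where the phase degenerates and the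
peaks of the walk arise. -/
lemma exists_waveNumber_bound (ha : 0 < a) (ha1 : a < 1) {r : ℝ} (hr : r < a) :
    ∃ k₁, 0 ≤ k₁ ∧ k₁ < Real.pi / 2 ∧ ∀ s, |s| ≤ r → |waveNumber a s| ≤ k₁ := by
  rcases lt_or_ge r 0 with h | h
  · exact ⟨0, le_rfl, by linarith [Real.pi_pos], fun s hs => absurd ((abs_nonneg s).trans hs) (by linarith)⟩
  have hsub : Set.Icc (-r) r ⊆ Set.Ioo (-a) a := fun s hs =>
    ⟨by linarith [hs.1], by linarith [hs.2]⟩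
  obtain ⟨s₀, hs₀, hmax⟩ := (isCompact_Icc (a := -r) (b := r)).exists_isMaxOn
    ⟨0, by constructor <;> linarith⟩ ((continuousOn_waveNumber ha ha1).mono hsub).abs
  refine ⟨|waveNumber a s₀|, abs_nonneg _, ?_, fun s hs => hmax (abs_le.mp hs)⟩
  exact abs_lt.mpr (waveNumber_mem ha ha1 (abs_lt.mpr (hsub hs₀)))

/-- Asymptotics of the oscillatory integral, uniformly for velocities in compact subsets of
`(-a, a)`. -/
lemma oscInt_asymptotic (ha : 0 < a) (ha1 : a < 1) {A A₁ : ℂ → ℝ → ℂ}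
    (hA : ∀ σ k, HasDerivAt (A σ) (A₁ σ k) k) (hA₁ : ∀ σ, Continuous (A₁ σ)) {r : ℝ} (hr : r < a)
    {ε : ℝ} (hε : 0 < ε) :
    ∀ᶠ n : ℕ in atTop, ∀ x : ℤ, |(x : ℝ) / n| ≤ r →
      ‖(√n : ℂ) * oscInt a A n x - lead a A (x / n) (n * phase a (x / n))‖ ≤ ε := by
  obtain ⟨k₁, hk0, hk1, hκ⟩ := exists_waveNumber_bound ha ha1 hr
  obtain ⟨c, hc, hc2, hc1⟩ := vel_sub_vel_lower ha ha1 hk0 hk1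
  have hpi := Real.pi_pos
  have hAc : ∀ σ, Continuous (A σ) := fun σ =>
    continuous_iff_continuousAt.mpr fun t => (hA σ t).continuousAt
  have sp := fun (B B₁ : ℝ → ℂ) (hB : ∀ t, HasDerivAt B (B₁ t) t) (hB₁ : Continuous B₁) =>
    stationary_phase_eventually (K := {k | |k| ≤ k₁}) (α := -(Real.pi / 2)) (β := Real.pi / 2)
      (ρ := Real.pi / 2 - k₁) (hasDerivAt_energy ha ha1)
      (hasDerivAt_vel ha ha1) (hasDerivAt_acc ha ha1) (continuous_jerk ha ha1) hB hB₁ hc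
      (by linarith) (by linarith) (fun k hk => by
        have := abs_le.mp (show |k| ≤ k₁ from hk)
        constructor <;> linarith) hc1 hc2 hε
  -- The second branch is the complex conjugate of an integral with the phase of the first, so the
  -- same estimate is applied to the conjugated amplitude.
  filter_upwards [sp (A Complex.I) (A₁ Complex.I) (hA _) (hA₁ _),
    sp (fun k => star (A (-Complex.I) k)) (fun k => star (A₁ (-Complex.I) k))
      (fun t => (hA _ t).star) (hA₁ _).star, eventually_ge_atTop 1] with n h1 h2 hn x hx
  have hn0 : (0 : ℝ) < n := by exact_mod_cast hn
  have hsa : |(x : ℝ) / n| < a := hx.trans_lt hr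
  set s : ℝ := x / n with hs
  set κ := waveNumber a s with hκdef
  have hκk : κ ∈ {k | |k| ≤ k₁} := hκ s hx
  have hvel : vel a κ = s := vel_waveNumber ha ha1 hsa
  have hacc : 0 < acc a κ := hc.trans_le (hc2 κ hκk)
  have hns : (n : ℝ) * s = x := by rw [hs]; field_simp
  have h1 := h1 κ hκk
  have h2 := h2 κ hκk
  rw [hvel] at h1 h2
  have hphase : ∀ k, (n : ℝ) * (energy a k - s * k) = n * energy a k - x * k := fun k => by
    rw [mul_sub, ← mul_assoc, hns]
  set θ := (n : ℝ) * phase a s with hθ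
  have hθ' : (n : ℝ) * (energy a κ - s * κ) = θ := by rw [hθ, phase, hκdef]
  rw [hθ'] at h1 h2
  set F := (2 * Real.pi * Complex.I / (n * acc a κ : ℝ)) ^ (1 / 2 : ℂ) with hF
  set G : ℂ := ((√(2 * Real.pi / acc a κ) : ℝ) : ℂ) with hG
  have hFG : (√n : ℂ) * F = G * sqrtI := sqrt_mul_fresnel hn0 hacc
  have hnorm : ∀ z : ℂ, √(n : ℝ) * ‖z‖ = ‖(√n : ℂ) * z‖ := fun z => by
    rw [norm_mul, Complex.norm_real, Real.norm_of_nonneg (Real.sqrt_nonneg _)]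
  set J₁ := ∫ k in (-(Real.pi / 2))..(Real.pi / 2),
    Complex.exp (Complex.I * (n * energy a k - x * k)) * A Complex.I k with hJ₁
  set J₂ := ∫ k in (-(Real.pi / 2))..(Real.pi / 2),
    Complex.exp (-Complex.I * (n * energy a k - x * k)) * A (-Complex.I) k with hJ₂
  have i1 : ∫ k in (-(Real.pi / 2))..(Real.pi / 2),
      Complex.exp (Complex.I * (n * (energy a k - s * k) : ℝ)) * A Complex.I k = J₁ := by
    apply intervalIntegral.integral_congr
    intro k _
    simp only
    rw [hphase]; push_cast; rfl
  have i2 : star (∫ k in (-(Real.pi / 2))..(Real.pi / 2),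
      Complex.exp (Complex.I * (n * (energy a k - s * k) : ℝ)) * star (A (-Complex.I) k)) = J₂ := by
    rw [RCLike.star_def, ← intervalIntegral.intervalIntegral_conj]
    apply intervalIntegral.integral_congr
    intro k _
    simp only
    rw [← RCLike.star_def, star_mul', star_star, star_exp_I, hphase]; push_cast; rfl
  rw [hnorm, i1] at h1
  rw [hnorm, ← norm_star, star_mul', star_sub, i2] at h2
  have hstar : star (√n : ℂ) = (√n : ℂ) := by rw [RCLike.star_def, Complex.conj_ofReal]
  have hstarG : star G = G := by rw [hG, RCLike.star_def, Complex.conj_ofReal]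
  have e2 : star (√n : ℂ) * (J₂ - star (Complex.exp (Complex.I * θ) * star (A (-Complex.I) κ) * F))
      = (√n : ℂ) * J₂ - G * (star sqrtI * Complex.exp (-Complex.I * θ) * A (-Complex.I) κ) := by
    have : (√n : ℂ) * star F = G * star sqrtI := by
      rw [← hstar, ← star_mul', hFG, star_mul', hstarG]
    rw [hstar, star_mul', star_mul', star_star, star_exp_I]
    linear_combination (-Complex.exp (-Complex.I * θ) * A (-Complex.I) κ) * this
  have e1 : (√n : ℂ) * (J₁ - Complex.exp (Complex.I * θ) * A Complex.I κ * F)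
      = (√n : ℂ) * J₁ - G * (sqrtI * Complex.exp (Complex.I * θ) * A Complex.I κ) := by
    linear_combination (-Complex.exp (Complex.I * θ) * A Complex.I κ) * hFG
  rw [e1] at h1
  rw [e2] at h2
  have hen := continuous_energy (a := a)
  have hAI := hAc Complex.I
  have hAnI := hAc (-Complex.I)
  have hosc : oscInt a A n x = 1 / (2 * Real.pi) * (J₁ + J₂) := by
    rw [oscInt, intervalIntegral.integral_add
      (Continuous.intervalIntegrable (by fun_prop) _ _)
      (Continuous.intervalIntegrable (by fun_prop) _ _)]
  have efin : (√n : ℂ) * oscInt a A n x - lead a A s θ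
      = 1 / (2 * Real.pi) *
        (((√n : ℂ) * J₁ - G * (sqrtI * Complex.exp (Complex.I * θ) * A Complex.I κ))
        + ((√n : ℂ) * J₂ - G * (star sqrtI * Complex.exp (-Complex.I * θ) * A (-Complex.I) κ))) := by
    rw [hosc, lead]; ring
  rw [efin, norm_mul]
  -- The prefactor is at most 1/2 and absorbs the sum of the two errors `ε`.
  have hc2 : ‖(1 / (2 * Real.pi) : ℂ)‖ ≤ 1 / 2 := by
    have : (1 / (2 * Real.pi) : ℂ) = ((1 / (2 * Real.pi) : ℝ) : ℂ) := by push_cast; rfl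
    rw [this, Complex.norm_real, Real.norm_of_nonneg (by positivity)]
    apply one_div_le_one_div_of_le (by norm_num)
    linarith [Real.pi_gt_three]
  calc _ ≤ 1 / 2 * (ε + ε) := mul_le_mul hc2 ((norm_add_le _ _).trans (add_le_add h1 h2))
        (norm_nonneg _) (by norm_num)
    _ = ε := by ring

end asymptotics

/-! ### Lattice sites, pointwise asymptotics and the oscillating factor -/

/-- The integer of the same parity as `n` in the interval `(n s - 1, n s + 1]`. -/
def site (n : ℕ) (s : ℝ) : ℤ := n + 2 * ⌊((n : ℝ) * s - n + 1) / 2⌋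

/-- The oscillating factor in the squared modulus of the amplitudes. -/
def oscFactor (a : ℝ) (n : ℕ) (s : ℝ) : ℂ :=
  Complex.exp (Complex.I * (2 * (n * phase a (site n s / n)) : ℝ))

lemma abs_site_sub_le (n : ℕ) (s : ℝ) : |(site n s : ℝ) - n * s| ≤ 1 := by
  have h1 := Int.floor_le (((n : ℝ) * s - n + 1) / 2)
  have h2 := Int.lt_floor_add_one (((n : ℝ) * s - n + 1) / 2)
  rw [site, abs_le]; push_cast
  constructor <;> linarith

lemma even_add_site (n : ℕ) (s : ℝ) : Even ((n : ℤ) + site n s) :=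
  ⟨n + ⌊((n : ℝ) * s - n + 1) / 2⌋, by rw [site]; ring⟩

/-- The two integers have the same parity and differ by less than `1 + 1 = 2`. -/
lemma eq_site {n : ℕ} {s : ℝ} {x : ℤ} (hx : |(x : ℝ) - n * s| < 1) (he : Even ((n : ℤ) + x)) :
    x = site n s := by
  have h1 := abs_lt.mp hx
  have h2 := abs_le.mp (abs_site_sub_le n s)
  have h3 : (x : ℝ) < site n s + 2 := by linarith [h1.2, h2.1]
  have h4 : (site n s : ℝ) < x + 2 := by linarith [h1.1, h2.2]
  have h3' : x < site n s + 2 := by exact_mod_cast h3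
  have h4' : site n s < x + 2 := by exact_mod_cast h4
  obtain ⟨j, hj⟩ := he
  obtain ⟨l, hl⟩ := even_add_site n s
  omega

lemma site_add {n : ℕ} (hn : 1 ≤ n) (s : ℝ) : site n (s + 2 / n) = site n s + 2 := by
  have hn0 : (0 : ℝ) < n := by exact_mod_cast hn
  have : ((n : ℝ) * (s + 2 / n) - n + 1) / 2 = ((n : ℝ) * s - n + 1) / 2 + 1 := by
    field_simp; ring
  rw [site, this, Int.floor_add_one, site]; ring

lemma measurable_site (n : ℕ) : Measurable (site n) := by
  unfold site
  have h : Measurable fun s : ℝ => ⌊((n : ℝ) * s - n + 1) / 2⌋ := by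
    exact Int.measurable_floor.comp (by fun_prop)
  exact (measurable_of_countable (fun z : ℤ => (n : ℤ) + 2 * z)).comp h

lemma measurable_oscFactor (a : ℝ) (n : ℕ) : Measurable (oscFactor a n) :=
  (measurable_of_countable (fun x : ℤ =>
    Complex.exp (Complex.I * (2 * (n * phase a (x / n)) : ℝ)))).comp (measurable_site n)

lemma norm_oscFactor (a : ℝ) (n : ℕ) (s : ℝ) : ‖oscFactor a n s‖ = 1 := norm_exp_I_ofReal _

lemma abs_site_div_sub_le {n : ℕ} (hn : 1 ≤ n) (s : ℝ) : |(site n s : ℝ) / n - s| ≤ 1 / n := by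
  have hn0 : (0 : ℝ) < n := by exact_mod_cast hn
  have : (site n s : ℝ) / n - s = ((site n s : ℝ) - n * s) / n := by field_simp
  rw [this, abs_div, abs_of_pos hn0]
  exact div_le_div_of_nonneg_right (abs_site_sub_le n s) hn0.le

lemma tendsto_site_div (s : ℝ) : Tendsto (fun n : ℕ => (site n s : ℝ) / n) atTop (𝓝 s) := by
  rw [tendsto_iff_norm_sub_tendsto_zero]
  refine squeeze_zero' (Eventually.of_forall fun _ => norm_nonneg _) ?_
    tendsto_one_div_atTop_nhds_zero_nat
  filter_upwards [eventually_ge_atTop 1] with n hn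
  exact abs_site_div_sub_le hn s

section asymptotics

variable {a : ℝ}

/-- Pointwise asymptotics of the squared modulus of the oscillatory integral. -/
lemma tendsto_normSq_oscInt (ha : 0 < a) (ha1 : a < 1) {A A₁ : ℂ → ℝ → ℂ}
    (hA : ∀ σ k, HasDerivAt (A σ) (A₁ σ k) k) (hA₁ : ∀ σ, Continuous (A₁ σ)) {s : ℝ} (hs : |s| < a) :
    Tendsto (fun n : ℕ => n * ‖oscInt a A n (site n s)‖ ^ 2
      - (meanPart a A s + (crossPart a A s * oscFactor a n s).re)) atTop (𝓝 0) := by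
  have hAc : ∀ σ, Continuous (A σ) := fun σ =>
    continuous_iff_continuousAt.mpr fun t => (hA σ t).continuousAt
  have hσ := tendsto_site_div s
  have hnhds : Set.Ioo (-a) a ∈ 𝓝 s := Ioo_mem_nhds (abs_lt.mp hs).1 (abs_lt.mp hs).2
  have hM : Tendsto (fun n : ℕ => meanPart a A (site n s / n)) atTop (𝓝 (meanPart a A s)) :=
    ((continuousOn_meanPart ha ha1 hAc).continuousAt hnhds).tendsto.comp hσ
  have hX : Tendsto (fun n : ℕ => crossPart a A (site n s / n)) atTop (𝓝 (crossPart a A s)) :=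
    ((continuousOn_crossPart ha ha1 hAc).continuousAt hnhds).tendsto.comp hσ
  -- The actual velocity `site n s / n` may exceed `|s|`; the midpoint leaves room for it.
  have hr : (|s| + a) / 2 < a := by linarith
  have hσr : ∀ᶠ n : ℕ in atTop, |(site n s : ℝ) / n| ≤ (|s| + a) / 2 :=
    hσ.abs.eventually_le_const (by linarith)
  set p : ℕ → ℂ := fun n => (√n : ℂ) * oscInt a A n (site n s) with hp
  set q : ℕ → ℂ := fun n => lead a A (site n s / n) (n * phase a (site n s / n)) with hq
  have hd : Tendsto (fun n => ‖p n - q n‖) atTop (𝓝 0) := by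
    rw [Metric.tendsto_nhds]
    intro ε hε
    filter_upwards [oscInt_asymptotic ha ha1 hA hA₁ hr (half_pos hε), hσr] with n h1 h2
    rw [Real.dist_eq, sub_zero, abs_of_nonneg (norm_nonneg _)]
    exact (h1 (site n s) h2).trans_lt (half_lt_self hε)
  set K := √(2 * (meanPart a A s + 1)) with hK
  have hqK : ∀ᶠ n in atTop, ‖q n‖ ≤ K := by
    filter_upwards [hσr, hM.eventually_le_const (lt_add_one _)] with n h1 h2
    apply Real.le_sqrt_of_sq_le
    exact (norm_lead_sq_le ha ha1 (h1.trans_lt hr) A _).trans (by linarith)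
  have hpq : Tendsto (fun n => ‖p n‖ ^ 2 - ‖q n‖ ^ 2) atTop (𝓝 0) := by
    have hlim : Tendsto (fun n => ‖p n - q n‖ * (‖p n - q n‖ + 2 * K)) atTop (𝓝 0) := by
      have := hd.mul (hd.add_const (2 * K))
      simpa using this
    refine squeeze_zero_norm' ?_ hlim
    filter_upwards [hqK] with n hn
    have h1 : |‖p n‖ - ‖q n‖| ≤ ‖p n - q n‖ := abs_norm_sub_norm_le _ _
    have h2 : ‖p n‖ + ‖q n‖ ≤ ‖p n - q n‖ + 2 * K := by linarith [(abs_le.mp h1).2]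
    rw [sq_sub_sq, Real.norm_eq_abs, abs_mul, mul_comm]
    exact mul_le_mul h1 (by rwa [abs_of_nonneg (by positivity)]) (abs_nonneg _) (norm_nonneg _)
  -- The coefficients are continuous and may be moved from `site n s / n` to `s`. The oscillating
  -- factor may not: its phase carries a factor `n`, so it keeps the true site.
  have hqlim : Tendsto (fun n => ‖q n‖ ^ 2
      - (meanPart a A s + (crossPart a A s * oscFactor a n s).re)) atTop (𝓝 0) := by
    have h1 : Tendsto (fun n : ℕ => (meanPart a A (site n s / n) - meanPart a A s)
        + ((crossPart a A (site n s / n) - crossPart a A s) * oscFactor a n s).re) atTop (𝓝 0) := by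
      have hz : Tendsto (fun n : ℕ => ((crossPart a A (site n s / n) - crossPart a A s)
          * oscFactor a n s).re) atTop (𝓝 0) := by
        refine squeeze_zero_norm (fun n => ?_) (tendsto_iff_norm_sub_tendsto_zero.mp hX)
        exact re_mul_exp_le _ _
      simpa using (hM.sub_const (meanPart a A s)).add hz
    refine h1.congr' ?_
    filter_upwards [hσr] with n hn
    rw [norm_lead_sq ha ha1 (hn.trans_lt hr), sub_mul, Complex.sub_re, oscFactor]
    ring
  have := hpq.add hqlim
  rw [add_zero] at this
  refine this.congr fun n => ?_
  have : ‖p n‖ ^ 2 = n * ‖oscInt a A n (site n s)‖ ^ 2 := by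
    rw [hp, norm_mul, mul_pow, Complex.norm_real, Real.norm_of_nonneg (Real.sqrt_nonneg _),
      Real.sq_sqrt (Nat.cast_nonneg n)]
  rw [← this]; ring

/-- Locally uniform upper bound for the squared modulus of the oscillatory integral. -/
lemma eventually_normSq_oscInt_le (ha : 0 < a) (ha1 : a < 1) {A A₁ : ℂ → ℝ → ℂ}
    (hA : ∀ σ k, HasDerivAt (A σ) (A₁ σ k) k) (hA₁ : ∀ σ, Continuous (A₁ σ))
    (hpos : ∀ s, |s| < a → 0 < meanPart a A s) {r : ℝ} (hr : r < a) :
    ∀ᶠ n : ℕ in atTop, ∀ s, |s| ≤ r →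
      n * ‖oscInt a A n (site n s)‖ ^ 2 ≤ 10 * meanPart a A s := by
  rcases lt_or_ge r 0 with h | h
  · exact Eventually.of_forall fun n s hs => absurd ((abs_nonneg s).trans hs) (by linarith)
  have hAc : ∀ σ, Continuous (A σ) := fun σ =>
    continuous_iff_continuousAt.mpr fun t => (hA σ t).continuousAt
  set r' := (r + a) / 2 with hr'
  have hr'a : r' < a := by linarith
  have hsub : Set.Icc (-r') r' ⊆ Set.Ioo (-a) a := fun s hs =>
    ⟨by linarith [hs.1], by linarith [hs.2]⟩
  have hcont := (continuousOn_meanPart ha ha1 hAc).mono hsub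
  have hcpt : IsCompact (Set.Icc (-r') r') := isCompact_Icc
  obtain ⟨s₀, hs₀, hmin⟩ := hcpt.exists_isMinOn ⟨0, by constructor <;> linarith⟩ hcont
  set m := meanPart a A s₀ with hm
  have hm0 : 0 < m := hpos s₀ (abs_lt.mpr (hsub hs₀))
  obtain ⟨δ, hδ, huc⟩ := Metric.uniformContinuousOn_iff.mp
    (hcpt.uniformContinuousOn_of_continuous hcont) m hm0
  have hlim : Tendsto (fun n : ℕ => 1 / (n : ℝ)) atTop (𝓝 0) := tendsto_one_div_atTop_nhds_zero_nat
  filter_upwards [oscInt_asymptotic ha ha1 hA hA₁ hr'a (Real.sqrt_pos.mpr hm0),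
    hlim.eventually_lt_const hδ, hlim.eventually_le_const (show 0 < r' - r by linarith),
    eventually_ge_atTop 1] with n h1 h2 h3 h4 s hs
  have hd := abs_site_div_sub_le h4 s
  set σ : ℝ := (site n s : ℝ) / n with hσ
  have hσr : |σ| ≤ r' := by
    have : |σ| ≤ |σ - s| + |s| := by simpa using abs_add_le (σ - s) s
    linarith
  have hsI : s ∈ Set.Icc (-r') r' := abs_le.mp (hs.trans (by linarith))
  have h5 := h1 (site n s) hσr
  have h6 := huc σ (abs_le.mp hσr) s hsI (by rw [Real.dist_eq]; linarith)
  have h7 : m ≤ meanPart a A s := hmin hsI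
  rw [Real.dist_eq] at h6
  have h8 := (abs_lt.mp h6).2
  have h9 := norm_lead_sq_le ha ha1 (hσr.trans_lt hr'a) A (n * phase a σ)
  set p := (√n : ℂ) * oscInt a A n (site n s) with hp
  set q := lead a A σ (n * phase a σ) with hq
  have hpn : ‖p‖ ^ 2 = n * ‖oscInt a A n (site n s)‖ ^ 2 := by
    rw [hp, norm_mul, mul_pow, Complex.norm_real, Real.norm_of_nonneg (Real.sqrt_nonneg _),
      Real.sq_sqrt (Nat.cast_nonneg n)]
  rw [← hpn]
  have hpq : ‖p‖ ≤ ‖q‖ + √m := by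
    have := norm_sub_norm_le p q
    linarith
  have hsq : √m ^ 2 = m := Real.sq_sqrt hm0.le
  have : ‖p‖ ^ 2 ≤ (‖q‖ + √m) ^ 2 := pow_le_pow_left₀ (norm_nonneg _) hpq 2
  -- The constant 10: `(‖q‖ + √m)² ≤ 2‖q‖² + 2m`, where `‖q‖²` is at most twice the mean at `σ`,
  -- hence at most four times the mean at `s`, and `m` is at most the mean at `s`.
  nlinarith [sq_nonneg (‖q‖ - √m)]

/-- As for a Legendre transform, the terms with `κ'` cancel because `ω'(κ(s)) = s`. Strictness is
needed because both points of the difference quotient used below move with `n`. -/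
lemma hasStrictDerivAt_phase (ha : 0 < a) (ha1 : a < 1) {s : ℝ} (hs : |s| < a) :
    HasStrictDerivAt (phase a) (-waveNumber a s) s := by
  have hnhds : ∀ᶠ t in 𝓝 s, |t| < a := by
    have := Ioo_mem_nhds (abs_lt.mp hs).1 (abs_lt.mp hs).2
    filter_upwards [this] with t ht using abs_lt.mpr ht
  apply hasStrictDerivAt_of_hasDerivAt_of_continuousAt (f' := fun t => -waveNumber a t)
  · filter_upwards [hnhds] with t ht
    have hκ : HasDerivAt (waveNumber a) (deriv (waveNumber a) t) t :=
      ((contDiffAt_waveNumber ha ha1 ht).differentiableAt one_ne_zero).hasDerivAt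
    have h := ((hasDerivAt_energy ha ha1 (waveNumber a t)).comp t hκ).fun_sub
      ((hasDerivAt_id' t).fun_mul hκ)
    rw [vel_waveNumber ha ha1 ht] at h
    exact h.congr_deriv (by ring)
  · exact (contDiffAt_waveNumber ha ha1 hs).continuousAt.neg

/-- The site moves by exactly 2, so the doubled phase changes by `2n · (2/n) · (-κ) = -4κ` in the
limit. -/
lemma tendsto_oscFactor_shift (ha : 0 < a) (ha1 : a < 1) {s : ℝ} (hs : |s| < a) :
    Tendsto (fun n : ℕ => oscFactor a n (s + 2 / n)
      - oscFactor a n s * Complex.exp (-(4 * Complex.I * waveNumber a s))) atTop (𝓝 0) := by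
  have hσ := tendsto_site_div s
  have h2 : Tendsto (fun n : ℕ => 2 / (n : ℝ)) atTop (𝓝 0) := tendsto_const_div_atTop_nhds_zero_nat 2
  have hpair : Tendsto (fun n : ℕ => ((site n s : ℝ) / n + 2 / n, (site n s : ℝ) / n)) atTop
      (𝓝 (s, s)) := by
    have := (hσ.add h2).prodMk_nhds hσ
    simpa using this
  have hlo := (hasStrictDerivAt_phase ha ha1 hs).isLittleO.comp_tendsto hpair
  have hlim : Tendsto (fun n : ℕ => (n : ℝ) * (phase a ((site n s : ℝ) / n + 2 / n)
      - phase a ((site n s : ℝ) / n))) atTop (𝓝 (-(2 * waveNumber a s))) := by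
    rw [tendsto_iff_norm_sub_tendsto_zero]
    have := hlo.norm_right.tendsto_div_nhds_zero.norm.const_mul 2
    rw [norm_zero, mul_zero] at this
    refine this.congr' ?_
    filter_upwards [eventually_ge_atTop 1] with n hn
    have hn0 : (0 : ℝ) < n := by exact_mod_cast hn
    simp only [Function.comp_apply, add_sub_cancel_left]
    rw [norm_div, norm_norm, Real.norm_of_nonneg (by positivity : (0:ℝ) ≤ 2 / n),
      show (2:ℝ) * (‖phase a ((site n s : ℝ) / n + 2 / n) - phase a ((site n s : ℝ) / n)
        - ((ContinuousLinearMap.toSpanSingleton ℝ (-waveNumber a s)) (2 / (n : ℝ)))‖ / (2 / n))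
        = n * ‖phase a ((site n s : ℝ) / n + 2 / n) - phase a ((site n s : ℝ) / n)
        - ((ContinuousLinearMap.toSpanSingleton ℝ (-waveNumber a s)) (2 / (n : ℝ)))‖ by field_simp]
    rw [← Real.norm_of_nonneg hn0.le, ← norm_mul, Real.norm_of_nonneg hn0.le]
    congr 1
    simp only [ContinuousLinearMap.toSpanSingleton_apply, smul_eq_mul]
    field_simp
  have hexp : Tendsto (fun n : ℕ => Complex.exp (Complex.I * (2 * ((n : ℝ) *
      (phase a ((site n s : ℝ) / n + 2 / n) - phase a ((site n s : ℝ) / n))) : ℝ))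
      - Complex.exp (-(4 * Complex.I * waveNumber a s))) atTop (𝓝 0) := by
    have hc : Continuous fun t : ℝ => Complex.exp (Complex.I * (2 * t : ℝ)) := by fun_prop
    have := ((hc.tendsto _).comp hlim).sub_const (Complex.exp (-(4 * Complex.I * waveNumber a s)))
    have e0 : Complex.exp (Complex.I * (2 * -(2 * waveNumber a s) : ℝ))
        - Complex.exp (-(4 * Complex.I * waveNumber a s)) = 0 := by
      rw [sub_eq_zero]; congr 1; push_cast; ring
    rw [e0] at this
    exact this
  refine squeeze_zero_norm' ?_ (tendsto_zero_iff_norm_tendsto_zero.mp hexp)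
  filter_upwards [eventually_ge_atTop 1] with n hn
  have hn0 : (0 : ℝ) < n := by exact_mod_cast hn
  have e : oscFactor a n (s + 2 / n) = oscFactor a n s * Complex.exp (Complex.I * (2 * ((n : ℝ) *
      (phase a ((site n s : ℝ) / n + 2 / n) - phase a ((site n s : ℝ) / n))) : ℝ)) := by
    rw [oscFactor, oscFactor, site_add hn, ← Complex.exp_add]
    have : ((site n s + 2 : ℤ) : ℝ) / n = (site n s : ℝ) / n + 2 / n := by push_cast; ring
    rw [this]; push_cast; ring_nf
  rw [e, ← mul_sub, norm_mul, norm_oscFactor, one_mul]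

end asymptotics

/-! ### Weak convergence of the oscillating factor to zero -/

/-- Translations act continuously on `L¹(ℝ)`. -/
lemma tendsto_integral_norm_translate_sub {G : ℝ → ℂ} (hG : Integrable G) {h : ℕ → ℝ}
    (hh : Tendsto h atTop (𝓝 0)) :
    Tendsto (fun n => ∫ s, ‖G (s + h n) - G s‖) atTop (𝓝 0) := by
  have hmem : MemLp G 1 volume := memLp_one_iff_integrable.mpr hG
  have : Fact ((1 : ENNReal) ≠ ⊤) := ⟨ENNReal.one_ne_top⟩
  have hc : Continuous fun t : ℝ => DomAddAct.mk t +ᵥ hmem.toLp G :=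
    (continuous_id.vadd continuous_const).comp DomAddAct.continuous_mk
  have h1 := ((hc.tendsto 0).comp hh).sub_const (hmem.toLp G)
  rw [show DomAddAct.mk (0 : ℝ) = 0 from rfl, zero_vadd, sub_self] at h1
  refine (tendsto_zero_iff_norm_tendsto_zero.mp h1).congr fun n => ?_
  have hmem' : MemLp (fun s => G (h n +ᵥ s)) 1 volume :=
    hmem.comp_measurePreserving (measurePreserving_add_left volume (h n))
  have e1 : DomAddAct.mk (h n) +ᵥ hmem.toLp G = hmem'.toLp _ := DomAddAct.mk_vadd_toLp _ hmem
  simp only [Function.comp_apply]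
  rw [e1, ← MemLp.toLp_sub]
  refine (L1.norm_of_fun_eq_integral_norm
    (memLp_one_iff_integrable.mp (hmem'.sub hmem))).trans ?_
  simp only [Pi.sub_apply, vadd_eq_add, add_comm]

section weak

variable {a : ℝ}

/-- The integral of `z_n G` is invariant under translation by `2/n`. After translating, `G` may be
moved back by continuity in `L¹`, and `z_n(s + 2/n)` replaced by `z_n(s) exp(-4iκ(s))` by dominated
convergence. -/
lemma tendsto_integral_oscFactor_mul_one_sub (ha : 0 < a) (ha1 : a < 1) {G : ℝ → ℂ}
    (hG : Integrable G) (hG0 : ∀ s, ¬|s| < a → G s = 0) :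
    Tendsto (fun n => ∫ s, oscFactor a n s
      * ((1 - Complex.exp (-(4 * Complex.I * waveNumber a s))) * G s)) atTop (𝓝 0) := by
  set q : ℝ → ℂ := fun s => Complex.exp (-(4 * Complex.I * waveNumber a s)) with hq
  have hqm : Measurable q := by
    have := measurable_waveNumber (a := a)
    simp only [hq]; fun_prop
  have hqn : ∀ s, ‖q s‖ = 1 := fun s => by
    have := norm_exp_I_ofReal (-(4 * waveNumber a s))
    rw [← this]; simp only [hq]; congr 2; push_cast; ring
  have hzm : ∀ n, AEStronglyMeasurable (oscFactor a n) volume := fun n =>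
    (measurable_oscFactor a n).aestronglyMeasurable
  have hshm : ∀ (n : ℕ) (h : ℝ), AEStronglyMeasurable (fun s => oscFactor a n (s + h)) volume :=
    fun n h => ((measurable_oscFactor a n).comp (measurable_add_const h)).aestronglyMeasurable
  have hzi : ∀ (n : ℕ) (F : ℝ → ℂ), Integrable F → Integrable fun s => oscFactor a n s * F s :=
    fun n F hF => hF.bdd_mul (hzm n) (Eventually.of_forall fun s => (norm_oscFactor a n s).le)
  have hshi : ∀ (n : ℕ) (h : ℝ) (F : ℝ → ℂ), Integrable F →
      Integrable fun s => oscFactor a n (s + h) * F s :=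
    fun n h F hF => hF.bdd_mul (hshm n h)
      (Eventually.of_forall fun s => (norm_oscFactor a n (s + h)).le)
  have hqG : Integrable fun s => q s * G s :=
    hG.bdd_mul hqm.aestronglyMeasurable (Eventually.of_forall fun s => (hqn s).le)
  have h2 : Tendsto (fun n : ℕ => 2 / (n : ℝ)) atTop (𝓝 0) := tendsto_const_div_atTop_nhds_zero_nat 2
  have t1 : Tendsto (fun n : ℕ => ∫ s, oscFactor a n (s + 2 / n) * (G (s + 2 / n) - G s)) atTop
      (𝓝 0) := by
    refine squeeze_zero_norm (fun n => ?_) (tendsto_integral_norm_translate_sub hG h2)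
    refine (norm_integral_le_integral_norm _).trans (le_of_eq ?_)
    simp only [norm_mul, norm_oscFactor, one_mul]
  have t2 : Tendsto (fun n : ℕ => ∫ s, (oscFactor a n (s + 2 / n) - oscFactor a n s * q s) * G s) atTop
      (𝓝 0) := by
    have := tendsto_integral_of_dominated_convergence (μ := volume) (fun s => 2 * ‖G s‖)
      (F := fun (n : ℕ) s => (oscFactor a n (s + 2 / n) - oscFactor a n s * q s) * G s)
      (f := fun _ => 0)
      (fun n => ((hshm n _).sub ((hzm n).mul hqm.aestronglyMeasurable)).mul hG.1)
      (hG.norm.const_mul 2)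
      (fun n => Eventually.of_forall fun s => by
        rw [norm_mul]
        apply mul_le_mul_of_nonneg_right _ (norm_nonneg _)
        refine (norm_sub_le _ _).trans ?_
        rw [norm_mul, norm_oscFactor, norm_oscFactor, hqn]; norm_num)
      (Eventually.of_forall fun s => by
        by_cases hs : |s| < a
        · simpa using (tendsto_oscFactor_shift ha ha1 hs).mul_const (G s)
        · simp [hG0 s hs])
    simpa using this
  have := t1.add t2
  rw [add_zero] at this
  refine this.congr fun n => ?_
  have e1 : ∫ s, oscFactor a n (s + 2 / n) * G (s + 2 / n) = ∫ s, oscFactor a n s * G s :=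
    integral_add_right_eq_self (fun s => oscFactor a n s * G s) (2 / (n : ℝ))
  have i1 : Integrable fun s => oscFactor a n (s + 2 / n) * G (s + 2 / n) :=
    (hzi n G hG).comp_add_right (2 / (n : ℝ))
  have i2 := hshi n (2 / n) G hG
  have i3 := hzi n _ hqG
  have s1 : ∫ s, oscFactor a n (s + 2 / n) * (G (s + 2 / n) - G s)
      = (∫ s, oscFactor a n (s + 2 / n) * G (s + 2 / n)) - ∫ s, oscFactor a n (s + 2 / n) * G s := by
    rw [← integral_sub i1 i2]; simp only [mul_sub]
  have s2 : ∫ s, (oscFactor a n (s + 2 / n) - oscFactor a n s * q s) * G s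
      = (∫ s, oscFactor a n (s + 2 / n) * G s) - ∫ s, oscFactor a n s * (q s * G s) := by
    rw [← integral_sub i2 i3]; simp only [sub_mul, mul_assoc]
  have s3 : ∫ s, oscFactor a n s * ((1 - q s) * G s)
      = (∫ s, oscFactor a n s * G s) - ∫ s, oscFactor a n s * (q s * G s) := by
    rw [← integral_sub (hzi n G hG) i3]; simp only [sub_mul, mul_sub, one_mul]
  rw [s1, s2, s3, e1]; ring

/-- Since `|4κ| < 2π`, the exponential can be 1 only for `κ = 0`. -/
lemma exp_waveNumber_ne_one (ha : 0 < a) (ha1 : a < 1) {s : ℝ} (hs : |s| < a) (hs0 : s ≠ 0) :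
    Complex.exp (-(4 * Complex.I * waveNumber a s)) ≠ 1 := by
  intro h
  obtain ⟨m, hm⟩ := Complex.exp_eq_one_iff.mp h
  have hκ := waveNumber_mem ha ha1 hs
  have hpi := Real.pi_pos
  have e : -(4 * waveNumber a s) = m * (2 * Real.pi) := by
    have h1 : (Complex.I) * (-(4 * (waveNumber a s : ℂ))) = Complex.I * (m * (2 * Real.pi)) := by
      linear_combination hm
    exact_mod_cast mul_left_cancel₀ Complex.I_ne_zero h1
  have h1 : (m : ℝ) < 1 := by nlinarith [hκ.1]
  have h2 : (-1 : ℝ) < m := by nlinarith [hκ.2]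
  have h1' : m < 1 := by exact_mod_cast h1
  have h2' : -1 < m := by exact_mod_cast h2
  have : m = 0 := by omega
  rw [this] at e
  have : waveNumber a s = 0 := by push_cast at e; linarith
  exact hs0 ((waveNumber_zero_iff ha ha1 hs).mp this)

/-- The oscillating factor tends weakly to zero. -/
lemma tendsto_integral_oscFactor_mul (ha : 0 < a) (ha1 : a < 1) {g : ℝ → ℂ}
    (hg : Integrable g) (hg0 : ∀ s, ¬|s| < a → g s = 0) :
    Tendsto (fun n => ∫ s, oscFactor a n s * g s) atTop (𝓝 0) := by
  set d : ℝ → ℂ := fun s => 1 - Complex.exp (-(4 * Complex.I * waveNumber a s)) with hd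
  have hdm : Measurable d := by
    have := measurable_waveNumber (a := a)
    simp only [hd]; fun_prop
  -- On `T j` division by `d` costs at most a factor `j + 1`, so there the test function is `d`
  -- times an integrable function. The sets exhaust `(-a, a)` except for the null set `{0}`, so the
  -- remainder is small in `L¹`.
  set T : ℕ → Set ℝ := fun j => {s | 1 / ((j : ℝ) + 1) ≤ ‖d s‖} with hT
  have hTm : ∀ j, MeasurableSet (T j) := fun j => measurableSet_le measurable_const hdm.norm
  have hrem : Tendsto (fun j => ∫ s, ‖g s - (T j).indicator g s‖) atTop (𝓝 0) := by
    have := tendsto_integral_of_dominated_convergence (μ := volume) (fun s => ‖g s‖)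
      (F := fun (j : ℕ) s => ‖g s - (T j).indicator g s‖) (f := fun _ => 0)
      (fun j => (hg.1.sub (hg.1.indicator (hTm j))).norm) hg.norm
      (fun j => Eventually.of_forall fun s => by
        rw [norm_norm]
        by_cases h : s ∈ T j
        · simp [h]
        · simp [h])
      (by
        filter_upwards [compl_mem_ae_iff.mpr (measure_singleton (μ := volume) (0 : ℝ))] with s hs
        by_cases hsa : |s| < a
        · have hne : d s ≠ 0 := sub_ne_zero.mpr (exp_waveNumber_ne_one ha ha1 hsa hs).symm
          apply tendsto_const_nhds.congr'
          filter_upwards [(tendsto_one_div_add_atTop_nhds_zero_nat (𝕜 := ℝ)).eventually_le_const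
            (norm_pos_iff.mpr hne)] with j hj
          rw [Set.indicator_of_mem (show s ∈ T j from hj), sub_self, norm_zero]
        · simp only [hg0 s hsa, zero_sub, norm_neg]
          simp [Set.indicator, hg0 s hsa])
    simpa using this
  rw [Metric.tendsto_nhds]
  intro ε hε
  obtain ⟨j, hj⟩ := (hrem.eventually_lt_const (half_pos hε)).exists
  set G : ℝ → ℂ := (T j).indicator fun s => (d s)⁻¹ * g s with hG
  have hj0 : (0 : ℝ) < 1 / ((j : ℝ) + 1) := by positivity
  have hGi : Integrable G := by
    have h1 : G = fun s => (T j).indicator (fun s => (d s)⁻¹) s * g s := by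
      ext s; by_cases h : s ∈ T j <;> simp [hG, h]
    rw [h1]
    refine hg.bdd_mul (c := (j : ℝ) + 1) (hdm.inv.indicator (hTm j)).aestronglyMeasurable
      (Eventually.of_forall fun s => ?_)
    by_cases h : s ∈ T j
    · rw [Set.indicator_of_mem h, norm_inv]
      exact inv_le_of_inv_le₀ (by positivity) (by rw [← one_div]; exact h)
    · rw [Set.indicator_of_notMem h, norm_zero]; positivity
  have hGd : ∀ s, d s * G s = (T j).indicator g s := fun s => by
    by_cases h : s ∈ T j
    · have : d s ≠ 0 := norm_pos_iff.mp (hj0.trans_le h)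
      simp only [hG, Set.indicator_of_mem h]; field_simp
    · simp [hG, h]
  have hlim := tendsto_integral_oscFactor_mul_one_sub ha ha1 hGi (fun s hs => by
    simp [hG, Set.indicator, hg0 s hs])
  have hbd : ∀ (n : ℕ) (F : ℝ → ℂ), Integrable F → Integrable fun s => oscFactor a n s * F s :=
    fun n F hF => hF.bdd_mul (measurable_oscFactor a n).aestronglyMeasurable
      (Eventually.of_forall fun s => (norm_oscFactor a n s).le)
  filter_upwards [(Metric.tendsto_nhds.mp hlim) (ε / 2) (half_pos hε)] with n hn
  rw [dist_zero_right] at hn ⊢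
  have hTi := hg.indicator (hTm j)
  have e : ∫ s, oscFactor a n s * g s = (∫ s, oscFactor a n s * (g s - (T j).indicator g s))
      + ∫ s, oscFactor a n s * (d s * G s) := by
    simp only [hGd]
    rw [← integral_add (hbd n (fun s => g s - (T j).indicator g s) (hg.sub hTi)) (hbd n _ hTi)]
    congr 1; ext s; ring
  rw [e]
  have b1 : ‖∫ s, oscFactor a n s * (g s - (T j).indicator g s)‖ < ε / 2 := by
    refine lt_of_le_of_lt (norm_integral_le_integral_norm _) (lt_of_eq_of_lt ?_ hj)
    simp only [norm_mul, norm_oscFactor, one_mul]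
  exact (norm_add_le _ _).trans_lt (by linarith)

/-- A uniformly bounded sequence on `(-a, a)` that is asymptotically a multiple of the oscillating
factor tends weakly to zero. -/
lemma isWeakLimit_zero_of_oscFactor (ha : 0 < a) (ha1 : a < 1) {f : ℕ → ℝ → ℝ} {d : ℝ → ℂ} {K L : ℝ}
    (hfm : ∀ n, Measurable (f n)) (hfK : ∀ n s, |f n s| ≤ K) (hf0 : ∀ n s, ¬|s| < a → f n s = 0)
    (hdm : Measurable d) (hdL : ∀ s, |s| < a → ‖d s‖ ≤ L)
    (hlim : ∀ s, |s| < a → Tendsto (fun n => f n s - (d s * oscFactor a n s).re) atTop (𝓝 0)) :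
    IsWeakLimit f (fun _ => 0) := by
  have hI : MeasurableSet (Set.Ioo (-a) a) := measurableSet_Ioo
  have hIm : ∀ s, s ∈ Set.Ioo (-a) a ↔ |s| < a := fun s => abs_lt.symm
  have hfin : volume (Set.Ioo (-a) a) ≠ ⊤ := measure_Ioo_lt_top.ne
  have hmem : ∀ n, MemLp (f n) 2 volume := fun n => by
    refine (memLp_indicator_const 2 hI K (Or.inr hfin)).mono (hfm n).aestronglyMeasurable
      (Eventually.of_forall fun s => ?_)
    by_cases h : |s| < a
    · rw [Set.indicator_of_mem ((hIm s).mpr h)]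
      exact (hfK n s).trans (le_abs_self K)
    · rw [hf0 n s h, norm_zero]; positivity
  refine ⟨hmem, MemLp.zero', fun g hg y => ?_⟩
  simp only [zero_mul, integral_zero]
  -- Restricting `g` to a set of finite measure turns it from an `L²` into an `L¹` function and
  -- absorbs the endpoint `y`.
  set h : ℝ → ℝ := (Set.Iic y ∩ Set.Ioo (-a) a).indicator g with hh
  have hms : MeasurableSet (Set.Iic y ∩ Set.Ioo (-a) a) := measurableSet_Iic.inter hI
  have hhi : Integrable h := by
    have : IntegrableOn g (Set.Iic y ∩ Set.Ioo (-a) a) := by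
      have : IsFiniteMeasure (volume.restrict (Set.Iic y ∩ Set.Ioo (-a) a)) :=
        ⟨by rw [Measure.restrict_apply_univ]
            exact (measure_mono Set.inter_subset_right).trans_lt measure_Ioo_lt_top⟩
      exact (hg.restrict _).integrable (by norm_num)
    exact (integrable_indicator_iff hms).mpr this
  have hh0 : ∀ s, ¬|s| < a → h s = 0 := fun s hs =>
    Set.indicator_of_notMem (fun hm => hs ((hIm s).mp hm.2)) _
  have hfh : ∀ n, ∫ s in Set.Iic y, f n s * g s = ∫ s, f n s * h s := fun n => by
    rw [← integral_indicator measurableSet_Iic]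
    congr 1; ext s
    by_cases h1 : s ∈ Set.Iic y
    · by_cases h2 : |s| < a
      · rw [Set.indicator_of_mem h1, hh, Set.indicator_of_mem
          (show s ∈ Set.Iic y ∩ Set.Ioo (-a) a from ⟨h1, (hIm s).mpr h2⟩)]
      · rw [Set.indicator_of_mem h1, hf0 n s h2, zero_mul, zero_mul]
    · rw [Set.indicator_of_notMem h1, hh, Set.indicator_of_notMem (fun hm => h1 hm.1), mul_zero]
  simp only [hfh]
  set D : ℝ → ℂ := (Set.Ioo (-a) a).indicator d with hD
  have hDm : Measurable D := hdm.indicator hI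
  have hDL : ∀ s, ‖D s‖ ≤ |L| := fun s => by
    by_cases hs : |s| < a
    · rw [hD, Set.indicator_of_mem ((hIm s).mpr hs)]; exact (hdL s hs).trans (le_abs_self L)
    · rw [hD, Set.indicator_of_notMem (fun hm => hs ((hIm s).mp hm)), norm_zero]; positivity
  have hDh : Integrable fun s => D s * (h s : ℂ) :=
    (hhi.ofReal (𝕜 := ℂ)).bdd_mul hDm.aestronglyMeasurable (Eventually.of_forall hDL)
  have hw := tendsto_integral_oscFactor_mul ha ha1 hDh (fun s hs => by rw [hh0 s hs]; simp)
  have hzi : ∀ n, Integrable fun s => oscFactor a n s * (D s * (h s : ℂ)) := fun n =>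
    hDh.bdd_mul (measurable_oscFactor a n).aestronglyMeasurable
      (Eventually.of_forall fun s => (norm_oscFactor a n s).le)
  have hw' : Tendsto (fun n => ∫ s, (D s * oscFactor a n s).re * h s) atTop (𝓝 0) := by
    have := (Complex.continuous_re.tendsto 0).comp hw
    rw [Complex.zero_re] at this
    refine this.congr fun n => ?_
    simp only [Function.comp_apply]
    rw [← RCLike.re_eq_complex_re, ← integral_re (hzi n)]
    congr 1; ext s
    rw [RCLike.re_eq_complex_re, ← Complex.re_mul_ofReal]; ring_nf
  have hrest : Tendsto (fun n => ∫ s, (f n s - (D s * oscFactor a n s).re) * h s) atTop (𝓝 0) := by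
    have := tendsto_integral_of_dominated_convergence (μ := volume) (fun s => (K + |L|) * |h s|)
      (F := fun (n : ℕ) s => (f n s - (D s * oscFactor a n s).re) * h s) (f := fun _ => 0)
      (fun n => (((hfm n).sub (Complex.measurable_re.comp
        (hDm.mul (measurable_oscFactor a n)))).aestronglyMeasurable).mul hhi.1)
      (hhi.abs.const_mul _)
      (fun n => Eventually.of_forall fun s => by
        rw [norm_mul]
        apply mul_le_mul_of_nonneg_right _ (norm_nonneg _)
        refine (norm_sub_le _ _).trans (add_le_add (hfK n s) ?_)
        refine (Complex.abs_re_le_norm _).trans ?_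
        rw [norm_mul, norm_oscFactor, mul_one]; exact hDL s)
      (Eventually.of_forall fun s => by
        by_cases hs : |s| < a
        · rw [hD, Set.indicator_of_mem ((hIm s).mpr hs)]
          simpa using (hlim s hs).mul_const (h s)
        · simp [hh0 s hs])
    simpa using this
  have := hrest.add hw'
  rw [add_zero] at this
  refine this.congr fun n => ?_
  have hi2 : Integrable fun s => (D s * oscFactor a n s).re * h s := by
    refine hhi.bdd_mul (c := |L|) (Complex.measurable_re.comp
      (hDm.mul (measurable_oscFactor a n))).aestronglyMeasurable (Eventually.of_forall fun s => ?_)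
    refine (Complex.abs_re_le_norm _).trans ?_
    rw [norm_mul, norm_oscFactor, mul_one]; exact hDL s
  have hi1 : Integrable fun s => (f n s - (D s * oscFactor a n s).re) * h s := by
    have hfi : Integrable fun s => f n s * h s :=
      hhi.bdd_mul (c := K) (hfm n).aestronglyMeasurable (Eventually.of_forall fun s => hfK n s)
    refine (hfi.sub hi2).congr (Eventually.of_forall fun s => ?_)
    simp only [Pi.sub_apply]; ring
  rw [← integral_add hi1 hi2]
  congr 1; ext s; ring

end weak

/-! ### Amplitudes of the two numerators and their mean parts -/

/-- The amplitude belonging to `P Ψ`. -/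
def ampP (a b : ℝ) (u w σ : ℂ) (k : ℝ) : ℂ :=
  Complex.exp (σ * (energy a k + k : ℝ)) * ampL a b u w σ k

/-- The amplitude belonging to `Q Ψ`. -/
def ampQ (a b : ℝ) (u w σ : ℂ) (k : ℝ) : ℂ :=
  Complex.exp (σ * (energy a k - k : ℝ)) * ampR a b u w σ k

section amplitudes

variable {a b : ℝ}

/-- The shift in time and space adds `ω + k` to the phase, and this is absorbed into the amplitude.
Both numerators then share the same phase function at `(n, x)`, hence the same stationary point and
the same oscillating factor. -/
lemma oscInt_ampP (u w : ℂ) (n : ℕ) (x : ℤ) :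
    oscInt a (ampL a b u w) (n + 1) (x - 1) = oscInt a (ampP a b u w) n x := by
  unfold oscInt ampP
  congr 1
  apply intervalIntegral.integral_congr
  intro k _
  simp only
  rw [← mul_assoc, ← Complex.exp_add, ← mul_assoc, ← Complex.exp_add]
  congr 3 <;> (push_cast; ring)

lemma oscInt_ampQ (u w : ℂ) (n : ℕ) (x : ℤ) :
    oscInt a (ampR a b u w) (n + 1) (x + 1) = oscInt a (ampQ a b u w) n x := by
  unfold oscInt ampQ
  congr 1
  apply intervalIntegral.integral_congr
  intro k _
  simp only
  rw [← mul_assoc, ← Complex.exp_add, ← mul_assoc, ← Complex.exp_add]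
  congr 3 <;> (push_cast; ring)

lemma contDiff_sinE (ha : 0 < a) (ha1 : a < 1) : ContDiff ℝ 1 (sinE a) := by
  unfold sinE
  exact ContDiff.sqrt (by fun_prop) fun k => by linarith [sq_mul_cos_lt_one ha ha1 k]

lemma contDiff_vel (ha : 0 < a) (ha1 : a < 1) : ContDiff ℝ 1 (vel a) := by
  unfold vel
  exact ContDiff.div (by fun_prop) (contDiff_sinE ha ha1) fun k => (sinE_pos ha ha1 k).ne'

lemma contDiff_energy (ha : 0 < a) (ha1 : a < 1) : ContDiff ℝ 1 (energy a) := by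
  rw [contDiff_one_iff_deriv]
  refine ⟨fun k => (hasDerivAt_energy ha ha1 k).differentiableAt, ?_⟩
  rw [show deriv (energy a) = vel a from funext fun k => (hasDerivAt_energy ha ha1 k).deriv]
  exact continuous_vel ha ha1

lemma contDiff_ofReal_comp {f : ℝ → ℝ} (hf : ContDiff ℝ 1 f) : ContDiff ℝ 1 fun k => (f k : ℂ) :=
  Complex.ofRealCLM.contDiff.comp hf

lemma contDiff_ampL (ha : 0 < a) (ha1 : a < 1) (u w σ : ℂ) : ContDiff ℝ 1 (ampL a b u w σ) := by
  have h1 := contDiff_ofReal_comp (contDiff_vel ha ha1)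
  have h2 := contDiff_ofReal_comp ((contDiff_sinE ha ha1).inv fun k => (sinE_pos ha ha1 k).ne')
  have h3 := contDiff_ofReal_comp (f := fun k => k) contDiff_id
  unfold ampL
  simp only [div_eq_mul_inv, ← Complex.ofReal_inv]
  refine ((contDiff_const.sub h1).mul contDiff_const).sub (ContDiff.mul ?_ contDiff_const)
  exact (contDiff_const.mul (contDiff_const.mul h3).neg.cexp).mul h2

lemma contDiff_ampR (ha : 0 < a) (ha1 : a < 1) (u w σ : ℂ) : ContDiff ℝ 1 (ampR a b u w σ) := by
  have h1 := contDiff_ofReal_comp (contDiff_vel ha ha1)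
  have h2 := contDiff_ofReal_comp ((contDiff_sinE ha ha1).inv fun k => (sinE_pos ha ha1 k).ne')
  have h3 := contDiff_ofReal_comp (f := fun k => k) contDiff_id
  unfold ampR
  simp only [div_eq_mul_inv, ← Complex.ofReal_inv]
  refine (ContDiff.mul ?_ contDiff_const).add ((contDiff_const.add h1).mul contDiff_const)
  exact (contDiff_const.mul (contDiff_const.mul h3).cexp).mul h2

lemma contDiff_ampP (ha : 0 < a) (ha1 : a < 1) (u w σ : ℂ) : ContDiff ℝ 1 (ampP a b u w σ) :=
  (contDiff_const.mul (contDiff_ofReal_comp ((contDiff_energy ha ha1).add contDiff_id))).cexp.mul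
    (contDiff_ampL ha ha1 u w σ)

lemma contDiff_ampQ (ha : 0 < a) (ha1 : a < 1) (u w σ : ℂ) : ContDiff ℝ 1 (ampQ a b u w σ) :=
  (contDiff_const.mul (contDiff_ofReal_comp ((contDiff_energy ha ha1).sub contDiff_id))).cexp.mul
    (contDiff_ampR ha ha1 u w σ)

lemma norm_exp_mul_ofReal {σ : ℂ} (hσ : σ = Complex.I ∨ σ = -Complex.I) (x : ℝ) :
    ‖Complex.exp (σ * x)‖ = 1 := by
  rcases hσ with rfl | rfl
  · exact norm_exp_I_ofReal x
  · exact norm_exp_neg_I_ofReal x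

/-- The eigenspace is one-dimensional, so the components are proportional: `(1 - v) ampR = σ (b /
sinE) exp(σk) ampL`. Taking squared moduli, with `b² / sinE² = 1 - v²`, and cancelling `1 - v` gives
the claim. -/
lemma norm_amp_relation (ha : 0 < a) (ha1 : a < 1) (hab : a ^ 2 + b ^ 2 = 1) (u w : ℂ) {σ : ℂ}
    (hσ : σ = Complex.I ∨ σ = -Complex.I) (k : ℝ) :
    (1 - vel a k) * ‖ampQ a b u w σ k‖ ^ 2 = (1 + vel a k) * ‖ampP a b u w σ k‖ ^ 2 := by
  have hSp := sinE_pos ha ha1 k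
  have hS : (sinE a k : ℂ) ≠ 0 := by exact_mod_cast hSp.ne'
  have hV := abs_lt.mp (abs_vel_lt ha ha1 k)
  have hVS := one_sub_vel_sq ha ha1 k
  rw [show 1 - a ^ 2 = b ^ 2 by linarith] at hVS
  have hVSc : (1 : ℂ) - (vel a k : ℂ) ^ 2 = (b : ℂ) ^ 2 / (sinE a k : ℂ) ^ 2 := by exact_mod_cast hVS
  have H1 := sq_of_eq_I_or hσ
  have hexp : Complex.exp (σ * k) * Complex.exp (-(σ * k)) = 1 := by
    rw [← Complex.exp_add, add_neg_cancel, Complex.exp_zero]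
  have key : (1 - vel a k : ℂ) * ampR a b u w σ k
      = σ * (b / sinE a k : ℝ) * Complex.exp (σ * k) * ampL a b u w σ k := by
    have e : (1 - vel a k : ℂ) * ((1 + vel a k) * w) = (b : ℂ) ^ 2 / (sinE a k : ℂ) ^ 2 * w := by
      rw [← hVSc]; ring
    unfold ampL ampR
    push_cast
    rw [mul_add, e]
    linear_combination (σ ^ 2 * (b : ℂ) ^ 2 / (sinE a k : ℂ) ^ 2 * w) * hexp
      + ((b : ℂ) ^ 2 / (sinE a k : ℂ) ^ 2 * w) * H1
  have hn := congrArg (fun z => ‖z‖ ^ 2) key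
  have hσn : ‖σ‖ = 1 := by rcases hσ with rfl | rfl <;> simp
  simp only [norm_mul, mul_pow, hσn, norm_exp_mul_ofReal hσ, Complex.norm_real] at hn
  rw [show (1 - vel a k : ℂ) = ((1 - vel a k : ℝ) : ℂ) by push_cast; rfl, Complex.norm_real,
    Real.norm_eq_abs, sq_abs, Real.norm_eq_abs, sq_abs, div_pow, ← hVS] at hn
  unfold ampP ampQ
  rw [norm_mul, norm_mul, norm_exp_mul_ofReal hσ, norm_exp_mul_ofReal hσ, one_mul, one_mul]
  have h1 : (1 - vel a k) ≠ 0 := by linarith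
  apply mul_left_cancel₀ h1
  linear_combination hn

lemma meanPart_relation (ha : 0 < a) (ha1 : a < 1) (hab : a ^ 2 + b ^ 2 = 1) (u w : ℂ) {s : ℝ}
    (hs : |s| < a) :
    (1 - s) * meanPart a (ampQ a b u w) s = (1 + s) * meanPart a (ampP a b u w) s := by
  have h1 := norm_amp_relation ha ha1 hab u w (Or.inl rfl) (waveNumber a s)
  have h2 := norm_amp_relation ha ha1 hab u w (Or.inr rfl) (waveNumber a s)
  rw [vel_waveNumber ha ha1 hs] at h1 h2
  unfold meanPart
  rw [← mul_div_assoc, ← mul_div_assoc, mul_add, mul_add, h1, h2]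

/-- If both branches vanished, their difference would force `w = 0`, because `cos κ ≠ 0` inside the
peaks and `b ≠ 0`; then `u = 0` as well, against the normalization. -/
lemma meanPart_ampP_pos (ha : 0 < a) (ha1 : a < 1) (hb : b ≠ 0) {u w : ℂ}
    (huw : ‖u‖ ^ 2 + ‖w‖ ^ 2 = 1) {s : ℝ} (hs : |s| < a) :
    0 < meanPart a (ampP a b u w) s := by
  have hmem := waveNumber_mem ha ha1 hs
  have hacc := acc_pos ha ha1 hmem
  have hpi := Real.pi_pos
  set κ := waveNumber a s with hκ
  have hcos : ((Real.cos κ : ℝ) : ℂ) ≠ 0 := by exact_mod_cast (Real.cos_pos_of_mem_Ioo hmem).ne'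
  have hS : (sinE a κ : ℂ) ≠ 0 := by exact_mod_cast (sinE_pos ha ha1 κ).ne'
  have hbc : (b : ℂ) ≠ 0 := by exact_mod_cast hb
  have hV : (1 - vel a κ : ℂ) ≠ 0 := by
    have := abs_lt.mp (abs_vel_lt ha ha1 κ)
    exact_mod_cast (by linarith : (1 - vel a κ) ≠ 0)
  unfold meanPart
  rw [← hκ]
  refine div_pos ?_ (by positivity)
  by_contra hcon
  have h0 : ‖ampP a b u w Complex.I κ‖ ^ 2 = 0 ∧ ‖ampP a b u w (-Complex.I) κ‖ ^ 2 = 0 := by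
    have := sq_nonneg ‖ampP a b u w Complex.I κ‖
    have := sq_nonneg ‖ampP a b u w (-Complex.I) κ‖
    constructor <;> linarith
  have e1 : ampL a b u w Complex.I κ = 0 := by
    have := h0.1
    rw [ampP, norm_mul, norm_exp_mul_ofReal (Or.inl rfl), one_mul] at this
    simpa using this
  have e2 : ampL a b u w (-Complex.I) κ = 0 := by
    have := h0.2
    rw [ampP, norm_mul, norm_exp_mul_ofReal (Or.inr rfl), one_mul] at this
    simpa using this
  have x1 : Complex.exp (-(Complex.I * κ)) = Real.cos κ - Complex.I * Real.sin κ := by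
    have := exp_mul_ofReal_of_sq (Or.inr rfl) κ
    rw [neg_mul] at this
    rw [this]; ring
  have x2 : Complex.exp (-(-Complex.I * κ)) = Real.cos κ + Complex.I * Real.sin κ := by
    rw [neg_mul, neg_neg]; exact exp_mul_ofReal_of_sq (Or.inl rfl) κ
  unfold ampL at e1 e2
  rw [x1] at e1
  rw [x2] at e2
  have hw : w = 0 := by
    have : (2 * Complex.I * b * Real.cos κ / sinE a κ : ℂ) * w = 0 := by
      linear_combination e2 - e1
    rcases mul_eq_zero.mp this with h | h
    · exact absurd h (div_ne_zero (mul_ne_zero (mul_ne_zero (mul_ne_zero two_ne_zero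
        Complex.I_ne_zero) hbc) hcos) hS)
    · exact h
  rw [hw, mul_zero, sub_zero] at e1
  have hu : u = 0 := (mul_eq_zero.mp e1).resolve_left hV
  rw [hu, hw] at huw
  norm_num at huw

lemma measurable_meanPart (ha : 0 < a) (ha1 : a < 1) {A : ℂ → ℝ → ℂ} (hA : ∀ σ, Continuous (A σ)) :
    Measurable (meanPart a A) := by
  have hκ := measurable_waveNumber (a := a)
  have h1 := (hA Complex.I).measurable.comp hκ
  have h2 := (hA (-Complex.I)).measurable.comp hκ
  have h3 := (continuous_acc ha ha1).measurable.comp hκ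
  exact ((h1.norm.pow_const 2).add (h2.norm.pow_const 2)).div (measurable_const.mul h3)

lemma measurable_crossPart (ha : 0 < a) (ha1 : a < 1) {A : ℂ → ℝ → ℂ}
    (hA : ∀ σ, Continuous (A σ)) : Measurable (crossPart a A) := by
  have hκ := measurable_waveNumber (a := a)
  have h1 := (hA Complex.I).measurable.comp hκ
  have h2 := (hA (-Complex.I)).star.measurable.comp hκ
  have h3 := (continuous_acc ha ha1).measurable.comp hκ
  exact ((measurable_const.mul h1).mul h2).div
    (Complex.measurable_ofReal.comp (measurable_const.mul h3))

end amplitudes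

/-! ### Construction of the error functions -/

/-- The deviation of `n Y / w` from `t` inside `(-a, a)`, replaced by the deviation of `Y / X` from
`t` where `n X / w` is not yet controlled. -/
def deviation (a : ℝ) (w : ℝ → ℝ) (X Y : ℕ → ℝ → ℝ) (t : ℝ → ℝ) (n : ℕ) (s : ℝ) : ℝ :=
  open Classical in
  if |s| < a then
    -- The condition involves only `X`, so numerator and denominator switch normalization together.
    -- The bound 9 is `10 - 1`, with the 10 of `eventually_normSq_oscInt_le`; `1 ≤ n` allows `n` to
    -- be cancelled.
    if 1 ≤ n ∧ |n * X n s / w s - 1| ≤ 9 then n * Y n s / w s - t s else Y n s / X n s - t s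
  else 0

section deviation

variable {a : ℝ} {w t : ℝ → ℝ} {X Y : ℕ → ℝ → ℝ}

/-- At each `s` the first normalization applies for all large `n`, so the deviation is
asymptotically the oscillation `c / w`; the case distinction serves only to keep it uniformly
bounded. -/
lemma isWeakLimit_deviation (ha : 0 < a) (ha1 : a < 1) {c : ℝ → ℂ} (hw : Measurable w)
    (ht : Measurable t) (hX : ∀ n, Measurable (X n)) (hY : ∀ n, Measurable (Y n)) (hc : Measurable c)
    (hwpos : ∀ s, |s| < a → 0 < w s) (ht1 : ∀ s, |s| < a → |t s| ≤ 1)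
    (hY0 : ∀ n s, 0 ≤ Y n s) (hYX : ∀ n s, Y n s ≤ X n s)
    (hgood : ∀ s, |s| < a → ∀ᶠ n : ℕ in atTop, |n * X n s / w s - 1| ≤ 9)
    (hcw : ∀ s, |s| < a → ‖c s‖ ≤ w s)
    (hlim : ∀ s, |s| < a → Tendsto (fun n : ℕ => n * Y n s
      - (t s * w s + (c s * oscFactor a n s).re)) atTop (𝓝 0)) :
    IsWeakLimit (deviation a w X Y t) (fun _ => 0) := by
  -- `K = 11`: in the first case `n Y / w ≤ n X / w ≤ 10`, in the second `Y / X ≤ 1` (and 0 where `X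
  -- = 0`), and `|t| ≤ 1` is added. `L = 1` is the bound `‖c‖ ≤ w`.
  refine isWeakLimit_zero_of_oscFactor ha ha1 (K := 11) (L := 1) (d := fun s => c s / (w s : ℂ))
    (fun n => ?_) (fun n s => ?_) (fun n s hs => ?_) ?_ (fun s hs => ?_) (fun s hs => ?_)
  · unfold deviation
    refine Measurable.ite (measurableSet_lt measurable_id.abs measurable_const)
      (Measurable.ite ?_ ?_ ?_) measurable_const
    · exact (MeasurableSet.const _).inter
        (measurableSet_le ((((hX n).const_mul _).div hw).sub_const 1).abs measurable_const)
    · exact (((hY n).const_mul _).div hw).sub ht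
    · exact ((hY n).div (hX n)).sub ht
  · unfold deviation
    split_ifs with h1 h2
    · have hw0 := hwpos s h1
      have b1 : 0 ≤ n * Y n s / w s := div_nonneg (mul_nonneg (Nat.cast_nonneg _) (hY0 n s)) hw0.le
      have b2 : n * Y n s / w s ≤ n * X n s / w s :=
        div_le_div_of_nonneg_right (mul_le_mul_of_nonneg_left (hYX n s) (Nat.cast_nonneg _)) hw0.le
      have b3 := abs_le.mp h2.2
      have b4 := abs_le.mp (ht1 s h1)
      rw [abs_le]; constructor <;> linarith [b3.2, b4.1, b4.2]
    · have hX0 := (hY0 n s).trans (hYX n s)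
      have b1 : 0 ≤ Y n s / X n s := div_nonneg (hY0 n s) hX0
      have b2 : Y n s / X n s ≤ 1 := div_le_one_of_le₀ (hYX n s) hX0
      have b4 := abs_le.mp (ht1 s h1)
      rw [abs_le]; constructor <;> linarith [b4.1, b4.2]
    · norm_num
  · unfold deviation; rw [if_neg hs]
  · exact hc.div (Complex.measurable_ofReal.comp hw)
  · have hw0 := hwpos s hs
    rw [norm_div, Complex.norm_real, Real.norm_of_nonneg hw0.le, div_le_one hw0]
    exact hcw s hs
  · have hw0 := hwpos s hs
    have := (hlim s hs).div_const (w s)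
    rw [zero_div] at this
    refine this.congr' ?_
    filter_upwards [hgood s hs, eventually_ge_atTop 1] with n h1 h2
    rw [deviation, if_pos hs, if_pos ⟨h2, h1⟩]
    have e : (c s / (w s : ℂ) * oscFactor a n s).re = (c s * oscFactor a n s).re / w s := by
      rw [div_mul_eq_mul_div, Complex.div_ofReal_re]
    rw [e]
    field_simp
    ring

lemma deviation_of_good {n : ℕ} {s : ℝ} (hs : |s| < a) (hw : 0 < w s) (hn : 1 ≤ n)
    (hg : |n * X n s / w s - 1| ≤ 9) : n * Y n s = w s * (t s + deviation a w X Y t n s) := by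
  rw [deviation, if_pos hs, if_pos ⟨hn, hg⟩]
  field_simp
  ring

/-- Either the common factor `n / w` cancels, or the denominator is `X / X = 1` and the numerator is
already the quotient. -/
lemma deviation_quotient {n : ℕ} {s : ℝ} (hs : |s| < a) (hw : 0 < w s) (hX : X n s ≠ 0) :
    1 + deviation a w X X (fun _ => 1) n s ≠ 0 ∧
      Y n s / X n s = (t s + deviation a w X Y t n s) / (1 + deviation a w X X (fun _ => 1) n s) := by
  unfold deviation
  rw [if_pos hs, if_pos hs]
  split_ifs with h
  · have hn0 : (n : ℝ) ≠ 0 := by exact_mod_cast (by omega : n ≠ 0)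
    have e1 : 1 + (n * X n s / w s - 1) = n * X n s / w s := by ring
    have e2 : t s + (n * Y n s / w s - t s) = n * Y n s / w s := by ring
    rw [e1, e2]
    refine ⟨div_ne_zero (mul_ne_zero hn0 hX) hw.ne', ?_⟩
    field_simp
  · have e1 : 1 + (X n s / X n s - 1) = 1 := by rw [div_self hX]; ring
    have e2 : t s + (Y n s / X n s - t s) = Y n s / X n s := by ring
    rw [e1, e2]
    exact ⟨one_ne_zero, (div_one _).symm⟩

end deviation

lemma isWeakLimit_zero : IsWeakLimit (fun _ _ => 0) (fun _ => 0) :=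
  ⟨fun _ => MemLp.zero', MemLp.zero', fun g _ y => by simp⟩

end QWalk

end

/-! ### The decomposition inside the peaks -/

/-- Inside the peaks. The error terms are functions of `s` alone (for each `n`), and the site `x` is
any integer at distance less than `1` from `n s`; since `Ψ_n(x) = 0` unless `n + x` is even, at most
one such site carries a nonzero amplitude. Every sequence of integers with `x_n = n s + O(1/n)` is
eventually of this form. The last clause says that `ξ`, `η`, `ζ` come from decomposing the
numerators and the denominator of `p_n` and `q_n`, with a common factor `w(s)` that does not depend
on `n`. -/
theorem theorem1 (C : Matrix (Fin 2) (Fin 2) ℂ) (hC : C ∈ Matrix.unitaryGroup (Fin 2) ℂ)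
    (hb : C 0 1 ≠ 0)
    (φ : EuclideanSpace ℂ (Fin 2)) (hφ : ‖φ‖ = 1)
    (p q : ℕ → ℤ → ℝ)
    (hp : ∀ n x, ‖QWalk.act (QWalk.P C) (QWalk.Psi C φ n x)‖ ^ 2
      = p n x * ‖QWalk.Psi C φ n x‖ ^ 2)
    (hq : ∀ n x, ‖QWalk.act (QWalk.Q C) (QWalk.Psi C φ n x)‖ ^ 2
      = q n x * ‖QWalk.Psi C φ n x‖ ^ 2) :
    ∃ ξ η ζ : ℕ → ℝ → ℝ,
      QWalk.IsWeakLimit ξ (fun _ => 0) ∧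
      QWalk.IsWeakLimit η (fun _ => 0) ∧
      QWalk.IsWeakLimit ζ (fun _ => 0) ∧
      (∀ s : ℝ, |s| < ‖C 0 0‖ → ∀ (n : ℕ) (x : ℤ), |(x : ℝ) - n * s| < 1 →
        QWalk.Psi C φ n x ≠ 0 →
          1 + η n s ≠ 0 ∧
          p n x = (QWalk.tau1 s + ξ n s) / (1 + η n s) ∧
          q n x = ((1 - QWalk.tau1 s) + ζ n s) / (1 + η n s)) ∧
      (∃ w : ℝ → ℝ, (∀ s : ℝ, |s| < ‖C 0 0‖ → 0 < w s) ∧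
        ∀ r : ℝ, r < ‖C 0 0‖ → ∃ N : ℕ, ∀ n : ℕ, N ≤ n → ∀ s : ℝ, |s| ≤ r →
          ∀ x : ℤ, |(x : ℝ) - n * s| < 1 → Even ((n : ℤ) + x) →
            n * ‖QWalk.Psi C φ n x‖ ^ 2 = w s * (1 + η n s) ∧
            n * ‖QWalk.act (QWalk.P C) (QWalk.Psi C φ n x)‖ ^ 2
              = w s * (QWalk.tau1 s + ξ n s) ∧
            n * ‖QWalk.act (QWalk.Q C) (QWalk.Psi C φ n x)‖ ^ 2
              = w s * ((1 - QWalk.tau1 s) + ζ n s)) := by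
  open QWalk in
  -- For `a = 0` there is no velocity inside the peaks and zero errors suffice; the dispersion
  -- analysis requires `a > 0`.
  by_cases hC0 : C 0 0 = 0
  · have hneg : ∀ s : ℝ, ¬|s| < ‖C 0 0‖ := fun s => by
      rw [hC0, norm_zero]; exact not_lt.mpr (abs_nonneg s)
    refine ⟨fun _ _ => 0, fun _ _ => 0, fun _ _ => 0, isWeakLimit_zero, isWeakLimit_zero,
      isWeakLimit_zero, fun s hs => absurd hs (hneg s), fun _ => 1, fun s hs => absurd hs (hneg s),
      fun r hr => ⟨0, fun n _ s hs => absurd (hs.trans_lt hr) (hneg s)⟩⟩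
  obtain ⟨u, v, huv, hrep⟩ := exists_norm_Psi_eq_oscInt hC hC0 hb hφ
  have hab := unitary_row_norm hC
  have hsplit := fun n x => norm_sq_eq_act_add hC (Psi C φ n x)
  set a := ‖C 0 0‖ with ha_def
  set b := ‖C 0 1‖ with hb_def
  have ha : 0 < a := norm_pos_iff.mpr hC0
  have hb0 : 0 < b := norm_pos_iff.mpr hb
  have ha1 : a < 1 := by nlinarith
  set AP := ampP a b u v with hAP
  set AQ := ampQ a b u v with hAQ
  have dP : ∀ σ k, HasDerivAt (AP σ) (deriv (AP σ) k) k := fun σ k =>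
    ((contDiff_ampP ha ha1 u v σ).differentiable one_ne_zero k).hasDerivAt
  have dQ : ∀ σ k, HasDerivAt (AQ σ) (deriv (AQ σ) k) k := fun σ k =>
    ((contDiff_ampQ ha ha1 u v σ).differentiable one_ne_zero k).hasDerivAt
  have cdP : ∀ σ, Continuous (deriv (AP σ)) := fun σ =>
    (contDiff_ampP ha ha1 u v σ).continuous_deriv le_rfl
  have cdQ : ∀ σ, Continuous (deriv (AQ σ)) := fun σ =>
    (contDiff_ampQ ha ha1 u v σ).continuous_deriv le_rfl
  have cP : ∀ σ, Continuous (AP σ) := fun σ => (contDiff_ampP ha ha1 u v σ).continuous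
  have cQ : ∀ σ, Continuous (AQ σ) := fun σ => (contDiff_ampQ ha ha1 u v σ).continuous
  set XP : ℕ → ℝ → ℝ := fun n s => ‖act (P C) (Psi C φ n (site n s))‖ ^ 2 with hXP
  set XQ : ℕ → ℝ → ℝ := fun n s => ‖act (Q C) (Psi C φ n (site n s))‖ ^ 2 with hXQ
  set X : ℕ → ℝ → ℝ := fun n s => ‖Psi C φ n (site n s)‖ ^ 2 with hX
  have hXadd : ∀ n s, X n s = XP n s + XQ n s := fun n s => hsplit n _
  have hXP0 : ∀ n s, 0 ≤ XP n s := fun n s => sq_nonneg _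
  have hXQ0 : ∀ n s, 0 ≤ XQ n s := fun n s => sq_nonneg _
  have hX0 : ∀ n s, 0 ≤ X n s := fun n s => sq_nonneg _
  have mXP : ∀ n, Measurable (XP n) := fun n =>
    (measurable_of_countable fun x : ℤ => ‖act (P C) (Psi C φ n x)‖ ^ 2).comp (measurable_site n)
  have mXQ : ∀ n, Measurable (XQ n) := fun n =>
    (measurable_of_countable fun x : ℤ => ‖act (Q C) (Psi C φ n x)‖ ^ 2).comp (measurable_site n)
  have mX : ∀ n, Measurable (X n) := fun n =>
    (measurable_of_countable fun x : ℤ => ‖Psi C φ n x‖ ^ 2).comp (measurable_site n)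
  have eXP : ∀ n s, XP n s = ‖oscInt a AP n (site n s)‖ ^ 2 := fun n s => by
    have he : Even (((n + 1 : ℕ) : ℤ) + (site n s - 1)) := by
      rw [show ((n + 1 : ℕ) : ℤ) + (site n s - 1) = n + site n s by push_cast; ring]
      exact even_add_site n s
    simp only [hXP]
    rw [norm_sq_act_P_Psi, (hrep _ _ he).1, oscInt_ampP]
  have eXQ : ∀ n s, XQ n s = ‖oscInt a AQ n (site n s)‖ ^ 2 := fun n s => by
    have he : Even (((n + 1 : ℕ) : ℤ) + (site n s + 1)) := by
      rw [show ((n + 1 : ℕ) : ℤ) + (site n s + 1) = n + site n s + 2 by push_cast; ring]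
      exact (even_add_site n s).add even_two
    simp only [hXQ]
    rw [norm_sq_act_Q_Psi, (hrep _ _ he).2, oscInt_ampQ]
  set MP := meanPart a AP with hMP
  set MQ := meanPart a AQ with hMQ
  have hMPpos : ∀ s, |s| < a → 0 < MP s := fun s hs => meanPart_ampP_pos ha ha1 hb0.ne' huv hs
  have hrel : ∀ s, |s| < a → (1 - s) * MQ s = (1 + s) * MP s := fun s hs =>
    meanPart_relation ha ha1 hab u v hs
  have hMQpos : ∀ s, |s| < a → 0 < MQ s := fun s hs => by
    have h1 := abs_lt.mp hs
    have h2 : 0 < (1 - s) * MQ s := by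
      rw [hrel s hs]; exact mul_pos (by linarith) (hMPpos s hs)
    exact pos_of_mul_pos_right h2 (by linarith)
  -- The mean part of `n ‖Ψ_n‖²`. The relation `(1 - s) MQ = (1 + s) MP` makes `τ₁` the share of
  -- `MP` in this sum.
  set w : ℝ → ℝ := fun s => MP s + MQ s with hw
  have hwpos : ∀ s, |s| < a → 0 < w s := fun s hs => add_pos (hMPpos s hs) (hMQpos s hs)
  have hτP : ∀ s, |s| < a → tau1 s * w s = MP s := fun s hs => by
    rw [tau1]; simp only [hw]; linear_combination (1 / 2) * hrel s hs
  have hτQ : ∀ s, |s| < a → (1 - tau1 s) * w s = MQ s := fun s hs => by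
    rw [sub_mul, hτP s hs]; simp only [hw]; ring
  have mMP : Measurable MP := measurable_meanPart ha ha1 cP
  have mMQ : Measurable MQ := measurable_meanPart ha ha1 cQ
  have mw : Measurable w := mMP.add mMQ
  have mcP : Measurable (crossPart a AP) := measurable_crossPart ha ha1 cP
  have mcQ : Measurable (crossPart a AQ) := measurable_crossPart ha ha1 cQ
  have mτ : Measurable tau1 := by unfold tau1; fun_prop
  have bcP : ∀ s, |s| < a → ‖crossPart a AP s‖ ≤ MP s := fun s hs => norm_crossPart_le ha ha1 hs AP
  have bcQ : ∀ s, |s| < a → ‖crossPart a AQ s‖ ≤ MQ s := fun s hs => norm_crossPart_le ha ha1 hs AQ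
  have hgood : ∀ r, r < a → ∀ᶠ n : ℕ in atTop, ∀ s, |s| ≤ r → |n * X n s / w s - 1| ≤ 9 := by
    intro r hr
    filter_upwards [eventually_normSq_oscInt_le ha ha1 dP cdP hMPpos hr,
      eventually_normSq_oscInt_le ha ha1 dQ cdQ hMQpos hr] with n h1 h2 s hs
    have hw0 := hwpos s (hs.trans_lt hr)
    have b0 : 0 ≤ n * X n s / w s := div_nonneg (mul_nonneg (Nat.cast_nonneg _) (hX0 n s)) hw0.le
    have b1 : n * X n s / w s ≤ 10 := by
      rw [div_le_iff₀ hw0, hXadd, eXP, eXQ]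
      simp only [hw]
      linarith [h1 s hs, h2 s hs]
    rw [abs_le]; constructor <;> linarith
  have hgood' : ∀ s, |s| < a → ∀ᶠ n : ℕ in atTop, |n * X n s / w s - 1| ≤ 9 := fun s hs => by
    filter_upwards [hgood |s| hs] with n hn using hn s le_rfl
  have limP : ∀ s, |s| < a → Tendsto (fun n : ℕ => n * XP n s
      - (tau1 s * w s + (crossPart a AP s * oscFactor a n s).re)) atTop (𝓝 0) := fun s hs => by
    simp only [eXP, hτP s hs]; exact tendsto_normSq_oscInt ha ha1 dP cdP hs
  have limQ : ∀ s, |s| < a → Tendsto (fun n : ℕ => n * XQ n s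
      - ((1 - tau1 s) * w s + (crossPart a AQ s * oscFactor a n s).re)) atTop (𝓝 0) := fun s hs => by
    simp only [eXQ, hτQ s hs]; exact tendsto_normSq_oscInt ha ha1 dQ cdQ hs
  have hτ1 : ∀ s, |s| < a → |tau1 s| ≤ 1 := fun s hs => by
    have := abs_lt.mp hs
    rw [tau1, abs_le]; constructor <;> linarith
  have hτ2 : ∀ s, |s| < a → |1 - tau1 s| ≤ 1 := fun s hs => by
    have := abs_lt.mp hs
    rw [tau1, abs_le]; constructor <;> linarith
  refine ⟨deviation a w X XP tau1, deviation a w X X fun _ => 1,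
    deviation a w X XQ fun s => 1 - tau1 s, ?_, ?_, ?_, ?_, w, hwpos, ?_⟩
  · exact isWeakLimit_deviation ha ha1 mw mτ mX mXP mcP hwpos hτ1 hXP0
      (fun n s => by linarith [hXadd n s, hXQ0 n s]) hgood'
      (fun s hs => (bcP s hs).trans (by simp only [hw]; linarith [hMQpos s hs])) limP
  -- The denominator is the sum of the two numerators, so its oscillation is the sum of both cross
  -- terms.
  · refine isWeakLimit_deviation ha ha1 (c := fun s => crossPart a AP s + crossPart a AQ s) mw
      measurable_const mX mX (mcP.add mcQ) hwpos (fun s _ => by simp) hX0 (fun n s => le_rfl) hgood'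
      (fun s hs => (norm_add_le _ _).trans (add_le_add (bcP s hs) (bcQ s hs))) fun s hs => ?_
    have := (limP s hs).add (limQ s hs)
    rw [add_zero] at this
    refine this.congr fun n => ?_
    rw [hXadd, add_mul, Complex.add_re]; ring
  · exact isWeakLimit_deviation ha ha1 mw (measurable_const.sub mτ) mX mXQ mcQ hwpos hτ2 hXQ0
      (fun n s => by linarith [hXadd n s, hXP0 n s]) hgood'
      (fun s hs => (bcQ s hs).trans (by simp only [hw]; linarith [hMPpos s hs])) limQ
  · intro s hs n x hx hne
    -- A nonzero amplitude forces the parity, and the parity determines the site.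
    obtain rfl := eq_site hx (even_of_Psi_ne_zero n x hne)
    have hXne : X n s ≠ 0 := pow_ne_zero 2 (norm_ne_zero_iff.mpr hne)
    have hP := deviation_quotient (Y := XP) (t := tau1) hs (hwpos s hs) hXne
    have hQ := deviation_quotient (Y := XQ) (t := fun s => 1 - tau1 s) hs (hwpos s hs) hXne
    refine ⟨hP.1, ?_, ?_⟩
    · rw [← hP.2, eq_div_iff hXne]; exact (hp n _).symm
    · rw [← hQ.2, eq_div_iff hXne]; exact (hq n _).symm
  · intro r hr
    obtain ⟨N, hN⟩ := eventually_atTop.mp (hgood r hr)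
    -- The uniform bound puts all `|s| ≤ r` in the first case of `deviation` at once, which also
    -- demands `1 ≤ n`.
    refine ⟨max N 1, fun n hn s hs x hx he => ?_⟩
    obtain rfl := eq_site hx he
    have hsa := hs.trans_lt hr
    have hg := hN n ((le_max_left _ _).trans hn) s hs
    have hn1 : 1 ≤ n := (le_max_right _ _).trans hn
    exact ⟨deviation_of_good (Y := X) (t := fun _ => 1) hsa (hwpos s hsa) hn1 hg,
      deviation_of_good (Y := XP) hsa (hwpos s hsa) hn1 hg,
      deviation_of_good (Y := XQ) (t := fun s => 1 - tau1 s) hsa (hwpos s hsa) hn1 hg⟩
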